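/- **Setting.** Let $K\ge 2$ be even, $0\le N\le K$, $(t_{ij})\in\mathbb R^{K\times K}$ and $(v_{i_1i_2j_1j_2})\in\mathbb R^{K\times K\times K\times K}$. With $S=\begin{pmatrix}1&0\\0&-1\end{pmatrix}$, $A=\begin{pmatrix}0&1\\0&0\end{pmatrix}$, $I$ the $2\times2$ identity and $Z=0$, let $\mathbf a_i=S^{\otimes(i-1)}\otimes A\otimes I^{\otimes(K-i)}$ act on $\mathbb R^{\{0,1\}^K}$, and let $$\mathbf S=\sum_{i,j}t_{ij}\mathbf a_i^*\mathbf a_j,\qquad \mathbf D=\sum_{i_1,i_2,j_1,j_2}v_{i_1i_2j_1j_2}\mathbf a_{i_1}^*\mathbf a_{i_2}^*\mathbf a_{j_1}\mathbf a_{j_2}.$$ **Block-sparse MPS.** An MPS $\mathsf X=(X_1,\dots,X_K)$ with ranks $r_0=1,r_1,\dots,r_{K-1},r_K=1$ (some may be $0$) represents $\tau(\mathsf X)_\alpha=\sum_{j_0,\dots,j_K}\prod_kX_k(j_{k-1},\alpha_k,j_k)$; write $X_k^{\{\beta\}}=X_k(\cdot,\beta,\cdot)$. Put $\mathcal K_k=\{\max(0,N-K+k),\dots,\min(N,k)\}$.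 $\mathsf X$ is *block-sparse* (for $N$ particles) if the rank indices at each $k=0,\dots,K$ are partitioned into sets $\mathcal S_{k,n}$, $n\in\mathcal K_k$, with $\mathcal S_{0,0}=\mathcal S_{K,N}=\{1\}$, such that $X_k^{\{0\}}$ has nonzero entries only in the blocks $X^0_{k,n}=X_k^{\{0\}}|_{\mathcal S_{k-1,n}\times\mathcal S_{k,n}}$, $n\in\mathcal K_{k-1}\cap\mathcal K_k$ (unoccupied blocks), and $X_k^{\{1\}}$ only in the blocks $X^1_{k,n}=X_k^{\{1\}}|_{\mathcal S_{k-1,n}\times\mathcal S_{k,n+1}}$, $n\in\mathcal K_{k-1}\cap(\mathcal K_k-1)$ (occupied blocks). **MPO representations.** "Bond $k$" is the cut between sites $k$ and $k+1$. The following symbolic cores have entries that are linear combinations of the components $Z,I,S,A,A^*,A^*A$; unlisted entries are $Z$, and an arrow leads from the row index to the column index. (a) *$\mathbf S$, rank indices*: $\mathrm{id}$, $\mathrm{an}_j$, $\mathrm{cr}_i$, $\mathrm{done}$. At a bond $k<K/2$ ("left"), $i,j\le k$, and $\mathrm{done}$ is present iff $k\ge1$. At a bond $k\ge K/2$ ("right"),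 $i,j>k$, and $\mathrm{done}$ is present iff $k\le K-1$. *Left cores* $T_k$ (with left index sets on both sides): $\mathrm{id}\to\mathrm{id},\mathrm{an}_k,\mathrm{cr}_k,\mathrm{done}$ by $I,A,A^*,t_{kk}A^*A$; $\mathrm{an}_j\to\mathrm{an}_j,\mathrm{done}$ by $S,t_{kj}A^*$; $\mathrm{cr}_i\to\mathrm{cr}_i,\mathrm{done}$ by $S,t_{ik}A$; $\mathrm{done}\to\mathrm{done}$ by $I$. *Right cores* $T_k$: the same list with every arrow reversed. *Middle matrix* $M_T$ (left to right indices at bond $K/2$): entries $1$ at $(\mathrm{id},\mathrm{done})$, $(\mathrm{done},\mathrm{id})$; $t_{ij}$ at $(\mathrm{an}_j,\mathrm{cr}_i)$ and at $(\mathrm{cr}_i,\mathrm{an}_j)$; otherwise $0$. The representation of $\mathbf S$ is $T_1\bowtie\dots\bowtie T_{K/2}M_T\bowtie T_{K/2+1}\bowtie\dots\bowtie T_K$ ($\bowtie$ the strong Kronecker product); the index set at bond $K/2$ is the right one. (b) *$\mathbf D$, rank indices*: $\mathrm{id}$, $\mathrm{cr}_i$, $\mathrm{an}_j$, $\mathrm{ca}_{ij}$,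 $\mathrm{cc}_{i_1i_2}$ ($i_1<i_2$), $\mathrm{aa}_{j_1j_2}$ ($j_1<j_2$), $\mathrm{nA}_j$, $\mathrm{nC}_i$, $\mathrm{done}$. At a left bond $k$ the indices of $\mathrm{cr},\mathrm{an},\mathrm{ca},\mathrm{cc},\mathrm{aa}$ are $\le k$, those of $\mathrm{nA},\mathrm{nC}$ are $>k$, and $\mathrm{nA},\mathrm{nC},\mathrm{done}$ are present iff $k\ge2$; at a right bond the inequalities are exchanged ($>k$, resp. $\le k$) and $\mathrm{nA},\mathrm{nC},\mathrm{done}$ are present iff $k\le K-2$. Let $\tilde v_{i_1i_2j_1j_2}=v_{i_1i_2j_1j_2}+v_{i_2i_1j_2j_1}-v_{i_2i_1j_1j_2}-v_{i_1i_2j_2j_1}$ if $i_1<i_2$, $j_1<j_2$, and $0$ otherwise, and $w=-\tilde v$. *Left cores* $V_k$: $\mathrm{id}\to\mathrm{id},\mathrm{cr}_k,\mathrm{an}_k,\mathrm{ca}_{kk}$ by $I,A^*,A,A^*A$; $\mathrm{cr}_i\to\mathrm{cr}_i,\mathrm{ca}_{ik},\mathrm{cc}_{ik},\mathrm{nA}_j$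 by $S,A,A^*,w_{ikkj}A^*A$; $\mathrm{an}_j\to\mathrm{an}_j,\mathrm{ca}_{kj},\mathrm{aa}_{jk},\mathrm{nC}_i$ by $S,A^*,A,w_{kijk}A^*A$; $\mathrm{ca}_{ij}\to\mathrm{ca}_{ij},\mathrm{nA}_{j'},\mathrm{nC}_{i'},\mathrm{done}$ by $I,w_{ikjj'}A^*,w_{ii'jk}A,w_{ikjk}A^*A$; $\mathrm{cc}_{i_1i_2}\to\mathrm{cc}_{i_1i_2},\mathrm{nA}_j$ by $I,w_{i_1i_2kj}A$; $\mathrm{aa}_{j_1j_2}\to\mathrm{aa}_{j_1j_2},\mathrm{nC}_i$ by $I,w_{kij_1j_2}A^*$; $\mathrm{nA}_j\to\mathrm{nA}_j$ by $S$ ($j>k$) and $\mathrm{nA}_k\to\mathrm{done}$ by $A$; $\mathrm{nC}_i\to\mathrm{nC}_i$ by $S$ ($i>k$) and $\mathrm{nC}_k\to\mathrm{done}$ by $A^*$; $\mathrm{done}\to\mathrm{done}$ by $I$. *Right cores* $V_k$: $\mathrm{id}\to\mathrm{id}$ by $I$; $\mathrm{cr}_k\to\mathrm{id}$ by $A^*$;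 $\mathrm{an}_k\to\mathrm{id}$ by $A$; $\mathrm{ca}_{kk}\to\mathrm{id}$ by $A^*A$; $\mathrm{cr}_i\to\mathrm{cr}_i$, $\mathrm{an}_j\to\mathrm{an}_j$ by $S$; $\mathrm{ca}_{ik}\to\mathrm{cr}_i$ by $A$; $\mathrm{ca}_{kj}\to\mathrm{an}_j$ by $A^*$; $\mathrm{cc}_{ki}\to\mathrm{cr}_i$ by $A^*$; $\mathrm{aa}_{kj}\to\mathrm{an}_j$ by $A$; $\mathrm{ca}_{ij}\to\mathrm{ca}_{ij}$, $\mathrm{cc}_{i_1i_2}\to\mathrm{cc}_{i_1i_2}$, $\mathrm{aa}_{j_1j_2}\to\mathrm{aa}_{j_1j_2}$ by $I$; $\mathrm{nA}_j\to\mathrm{nA}_j,\mathrm{cc}_{i_1i_2},\mathrm{ca}_{ij'},\mathrm{cr}_i$ by $S,w_{i_1i_2jk}A,w_{kijj'}A^*,w_{kijk}A^*A$; $\mathrm{nC}_i\to\mathrm{nC}_i,\mathrm{aa}_{j_1j_2},\mathrm{ca}_{i'j},\mathrm{an}_j$ by $S,w_{ikj_1j_2}A^*,w_{ii'kj}A,w_{ikkj}A^*A$;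 $\mathrm{done}\to\mathrm{done},\mathrm{nA}_k,\mathrm{nC}_k,\mathrm{ca}_{ij}$ by $I,A,A^*,w_{kikj}A^*A$. *Middle matrix* $M_V$: entries $1$ at $(\mathrm{id},\mathrm{done})$, $(\mathrm{done},\mathrm{id})$, $(\mathrm{cr}_i,\mathrm{nC}_i)$, $(\mathrm{an}_j,\mathrm{nA}_j)$, $(\mathrm{nA}_j,\mathrm{an}_j)$, $(\mathrm{nC}_i,\mathrm{cr}_i)$; $w_{i_1i_2j_1j_2}$ at $(\mathrm{ca}_{i_1j_1},\mathrm{ca}_{i_2j_2})$, $(\mathrm{cc}_{i_1i_2},\mathrm{aa}_{j_1j_2})$, $(\mathrm{aa}_{j_1j_2},\mathrm{cc}_{i_1i_2})$; otherwise $0$. The representation of $\mathbf D$ is $V_1\bowtie\dots\bowtie V_{K/2}M_V\bowtie V_{K/2+1}\bowtie\dots\bowtie V_K$. **Block operations.** To each rank index $m$ assign a shift $s(m)$: at left bonds $s=0$ for $\mathrm{id},\mathrm{ca},\mathrm{done}$; $s=1$ for $\mathrm{cr},\mathrm{nA}$; $s=-1$ for $\mathrm{an},\mathrm{nC}$; $s=2$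 for $\mathrm{cc}$; $s=-2$ for $\mathrm{aa}$; at right bonds the negatives of these numbers. Replace each component in row $m$ of a core by the block operation with shift $s=s(m)$, which maps the blocks $X^0_{k,n},X^1_{k,n}$ of a core to the blocks with $$\begin{aligned}I&:\ Y^0_n=X^0_{k,n-s},\ Y^1_n=X^1_{k,n-s}; & S&:\ Y^0_n=X^0_{k,n-s},\ Y^1_n=-X^1_{k,n-s}; & A&:\ Y^0_n=X^1_{k,n-s},\ Y^1_n=0;\\ A^*&:\ Y^0_n=0,\ Y^1_n=X^0_{k,n-s}; & A^*A&:\ Y^0_n=0,\ Y^1_n=X^1_{k,n-s}; & Z&:\ Y^0_n=Y^1_n=0,\end{aligned}$$ where only $n\in\mathcal K_{k-1}\cap\mathcal K_k$ for $Y^0_n$ and $n\in\mathcal K_{k-1}\cap(\mathcal K_k-1)$ for $Y^1_n$ are kept, and absent source blocks are zero. This gives $\mathsf S_{\mathrm b}$ and $\mathsf D_{\mathrm b}$. The mode core product $\mathsf S_{\mathrm b}\bullet\mathsf X$ (likewise $\mathsf D_{\mathrm b}\bullet\mathsf X$) has as rank indices at bond $k$ the pairs $(m,j)$ of a rank index $m$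 of the representation and $j\in\mathcal S_{k,n}$ with $n+s(m)\in\mathcal K_k$; such a pair is put into the set number $n+s(m)$. The part of its $k$-th core belonging to $(m,m')$ is the entry $(m,m')$ of the representation (a linear combination of block operations) applied to $X_k$. **Proposition.** Let $\mathbf x=\tau(\mathsf X)$ with $\mathsf X$ block-sparse for $N$ particles. Then $\mathsf U=\mathsf S_{\mathrm b}\bullet\mathsf X$ and $\mathsf V=\mathsf D_{\mathrm b}\bullet\mathsf X$, with the index sets just described, are block-sparse MPS representations for $N$ particles, and $\mathbf S\mathbf x=\tau(\mathsf U)$, $\mathbf D\mathbf x=\tau(\mathsf V)$. -/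

import Mathlib

noncomputable section

namespace FockMPS

/-! ### Elementary components and second quantization on `ℝ^{{0,1}^K}`

Sites (orbitals) are numbered `0, …, K - 1`, bonds `0, …, K`; site `k` lies between bond `k` and
bond `k + 1`. A tensor of order `K` is a function `(Fin K → Fin 2) → ℝ`. -/

/-- The symbols `Z` (zero), `I`, `S`, `A`, `A*`, `A*A` occurring in the operator cores. -/
inductive Comp
  | Z | I | S | A | Astar | AstarA

/-- The `2 × 2` matrices denoted by the symbols. -/
def Comp.toMatrix : Comp → Matrix (Fin 2) (Fin 2) ℝ
  | .Z => 0
  | .I => 1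
  | .S => !![1, 0; 0, -1]
  | .A => !![0, 1; 0, 0]
  | .Astar => !![0, 0; 1, 0]
  | .AstarA => !![0, 0; 0, 1]

/-- The annihilation operator `a_i = S ⊗ ⋯ ⊗ S ⊗ A ⊗ I ⊗ ⋯ ⊗ I`, with `A` at site `i`. -/
def annihilation {K : ℕ} (i : Fin K) : Matrix (Fin K → Fin 2) (Fin K → Fin 2) ℝ :=
  fun α β => ∏ k : Fin K,
    (if k < i then Comp.S else if k = i then Comp.A else Comp.I).toMatrix (α k) (β k)

/-- The creation operator `a_i^*`. -/
def creation {K : ℕ} (i : Fin K) : Matrix (Fin K → Fin 2) (Fin K → Fin 2) ℝ :=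
  (annihilation i).transpose

/-- The one-particle operator `∑ t_{ij} a_i^* a_j`. -/
def oneParticleOp {K : ℕ} (t : Fin K → Fin K → ℝ) :
    Matrix (Fin K → Fin 2) (Fin K → Fin 2) ℝ :=
  ∑ i, ∑ j, t i j • (creation i * annihilation j)

/-- The two-particle operator `∑ v_{i₁ i₂ j₁ j₂} a_{i₁}^* a_{i₂}^* a_{j₁} a_{j₂}`. -/
def twoParticleOp {K : ℕ} (v : Fin K → Fin K → Fin K → Fin K → ℝ) :
    Matrix (Fin K → Fin 2) (Fin K → Fin 2) ℝ :=
  ∑ i₁, ∑ i₂, ∑ j₁, ∑ j₂,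
    v i₁ i₂ j₁ j₂ • (creation i₁ * creation i₂ * annihilation j₁ * annihilation j₂)

/-! ### Block-sparse matrix product states -/

/-- The set `𝒦_k = {max(0, N - K + k), …, min(N, k)}` of possible particle numbers to the left
of bond `k`, for `N` particles in `K` orbitals. -/
def occRange (K N k : ℕ) : Finset ℤ :=
  Finset.Icc (max 0 ((N : ℤ) - K + k)) (min (N : ℤ) k)

/-- A matrix product state of order `K` whose rank indices are sorted into disjoint sets
`𝒮_{k,n} = {j : label k j = n}`. -/
structure MPS (K : ℕ) where
  /-- The finite set of rank indices at each bond. -/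
  Bond : Fin (K + 1) → Type
  fin : ∀ k, Fintype (Bond k)
  label : ∀ k, Bond k → ℤ
  core : ∀ k : Fin K, Bond k.castSucc → Fin 2 → Bond k.succ → ℝ

attribute [instance] MPS.fin

/-- The represented tensor `τ(X)`: the sum over all rank indices of the product of the cores. -/
def MPS.tensor {K : ℕ} (X : MPS K) : (Fin K → Fin 2) → ℝ :=
  fun α => ∑ p : (∀ k : Fin (K + 1), X.Bond k),
    ∏ k : Fin K, X.core k (p k.castSucc) (α k) (p k.succ)

/-- Block sparsity for `N` particles: boundary ranks `1` with `𝒮_{0,0}` and `𝒮_{K,N}` being the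
full (one-element) index sets, `𝒮_{k,n}` empty unless `n ∈ 𝒦_k`, and nonzero entries of
`X_k^{{0}}` only in the blocks `𝒮_{k-1,n} × 𝒮_{k,n}`, of `X_k^{{1}}` only in the blocks
`𝒮_{k-1,n} × 𝒮_{k,n+1}`. (The partial tensors of the sites left, resp. right of bond `k` with
index in `𝒮_{k,n}` are then supported on multi-indices with `n`, resp. `N - n` ones.) -/
structure MPS.IsBlockSparse {K : ℕ} (N : ℕ) (X : MPS K) : Prop where
  card_first : Fintype.card (X.Bond 0) = 1
  card_last : Fintype.card (X.Bond (Fin.last K)) = 1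
  label_first : ∀ j, X.label 0 j = 0
  label_last : ∀ j, X.label (Fin.last K) j = N
  label_mem : ∀ (k : Fin (K + 1)) (j : X.Bond k), X.label k j ∈ occRange K N k
  unocc_support : ∀ k i j, X.core k i 0 j ≠ 0 → X.label k.succ j = X.label k.castSucc i
  occ_support : ∀ k i j, X.core k i 1 j ≠ 0 → X.label k.succ j = X.label k.castSucc i + 1

/-! ### Block operations -/

/-- The family of the unoccupied and of the occupied blocks of a core, indexed by the particle
number to the left of the site. Every block is written as a matrix over all rank indices,
extended by zero outside of its own rows and columns. -/
structure BlockCore (R C : Type) where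
  unocc : ℤ → Matrix R C ℝ
  occ : ℤ → Matrix R C ℝ

/-- The blocks of the core at site `k` of a block-sparse matrix product state. -/
def MPS.blocks {K : ℕ} (X : MPS K) (k : Fin K) :
    BlockCore (X.Bond k.castSucc) (X.Bond k.succ) where
  unocc n := fun i j =>
    if X.label k.castSucc i = n ∧ X.label k.succ j = n then X.core k i 0 j else 0
  occ n := fun i j =>
    if X.label k.castSucc i = n ∧ X.label k.succ j = n + 1 then X.core k i 1 j else 0

/-- A block operation: a component together with the number `shift` of particles that the
operator has added (if negative: removed) to the left of the site. For one-particle operators,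
`A_l, A_r` are `A` with shift `0, 1`; `A*_l, A*_r` are `A*` with shift `0, -1`; `S⁺, S⁻` are `S`
with shift `1, -1`; `I_l, I_r` are `I` and `A*A` is `A*A` with shift `0`. -/
structure BlockOp where
  comp : Comp
  shift : ℤ

/-- The action of a block operation on a family of blocks: the block number `n` of the result is
zero or, up to sign, the unoccupied or occupied block number `n - shift` of the argument. -/
def BlockOp.act {R C : Type} (o : BlockOp) (Y : BlockCore R C) : BlockCore R C :=
  match o.comp with
  | .Z => ⟨fun _ => 0, fun _ => 0⟩
  | .I => ⟨fun n => Y.unocc (n - o.shift), fun n => Y.occ (n - o.shift)⟩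
  | .S => ⟨fun n => Y.unocc (n - o.shift), fun n => -Y.occ (n - o.shift)⟩
  | .A => ⟨fun n => Y.occ (n - o.shift), fun _ => 0⟩
  | .Astar => ⟨fun _ => 0, fun n => Y.unocc (n - o.shift)⟩
  | .AstarA => ⟨fun _ => 0, fun n => Y.occ (n - o.shift)⟩

/-- The two layers of a core at site `k`, assembled from those of its blocks whose number is
admissible: `n ∈ 𝒦_{k-1} ∩ 𝒦_k` for unoccupied and `n ∈ 𝒦_{k-1} ∩ (𝒦_k - 1)` for occupied blocks.
All other blocks are deleted. -/
def BlockCore.layer {R C : Type} (K N k : ℕ) (Y : BlockCore R C) (β : Fin 2) : Matrix R C ℝ :=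
  if β = 0 then ∑ n ∈ occRange K N k with n ∈ occRange K N (k + 1), Y.unocc n
  else ∑ n ∈ occRange K N k with n + 1 ∈ occRange K N (k + 1), Y.occ n

/-! ### Operator representations -/

/-- A matrix product operator in symbolic form: each entry of each core is a linear combination
of the components. -/
structure SymbolicMPO (K : ℕ) where
  Bond : Fin (K + 1) → Type
  fin : ∀ k, Fintype (Bond k)
  core : ∀ k : Fin K, Bond k.castSucc → Bond k.succ → Comp →₀ ℝ

attribute [instance] SymbolicMPO.fin

/-- A matrix product operator with particle number semantics: each entry of each core is a
linear combination of block operations, and each rank index carries the number `shift` of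
particles that have been added to the left of the bond. -/
structure BlockMPO (K : ℕ) where
  Bond : Fin (K + 1) → Type
  fin : ∀ k, Fintype (Bond k)
  shift : ∀ k, Bond k → ℤ
  core : ∀ k : Fin K, Bond k.castSucc → Bond k.succ → BlockOp →₀ ℝ

attribute [instance] BlockMPO.fin

/-- Replacement of every component by the corresponding position-dependent block operation. -/
def SymbolicMPO.toBlock {K : ℕ} (T : SymbolicMPO K) (shift : ∀ k, T.Bond k → ℤ) : BlockMPO K where
  Bond := T.Bond
  fin := T.fin
  shift := shift
  core k m m' := (T.core k m m').mapDomain fun c => ⟨c, shift k.castSucc m⟩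

open Classical in
/-- The mode core product `B • X` (at all sites) of a representation with particle number
semantics and a block-sparse matrix product state for `N` particles. Rank indices are pairs
`(m, j)`; an index `j ∈ 𝒮_{k,n}` becomes an index `(m, j)` of the block number `n + shift m`, and
is removed if this number is not in `𝒦_k`. -/
def BlockMPO.apply {K : ℕ} (B : BlockMPO K) (N : ℕ) (X : MPS K) : MPS K where
  Bond b := {p : B.Bond b × X.Bond b // X.label b p.2 + B.shift b p.1 ∈ occRange K N b}
  fin _ := inferInstance
  label b p := X.label b p.1.2 + B.shift b p.1.1
  core k p β q := (B.core k p.1.1 q.1.1).sum fun o c =>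
    c * (o.act (X.blocks k)).layer K N k β p.1.2 q.1.2

open Classical in
/-- A symbolic matrix product operator `L_1 ⋈ ⋯ ⋈ L_{K/2} M ⋈ R_{K/2+1} ⋈ ⋯ ⋈ R_K` with rank
indices from a finite type `Γ`. At bond `b < K/2` the indices satisfying `liveL b` are present,
at bond `b ≥ K/2` those satisfying `liveR b`. -/
def glue {Γ : Type} [Fintype Γ] (K : ℕ) (liveL liveR : ℕ → Γ → Prop)
    (L R : Fin K → Γ → Γ → Comp →₀ ℝ) (M : Γ → Γ → ℝ) : SymbolicMPO K where
  Bond b := {c : Γ // if (b : ℕ) < K / 2 then liveL b c else liveR b c}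
  fin _ := inferInstance
  core k m m' :=
    if (k : ℕ) + 1 < K / 2 then L k m m'
    else if (k : ℕ) + 1 = K / 2 then ∑ c : Γ with liveL (k + 1) c, M c m' • L k m c
    else R k m m'

/-- `entry c a` is the component `c` with coefficient `a`. -/
abbrev entry (c : Comp) (a : ℝ) : Comp →₀ ℝ := Finsupp.single c a

/-- `delta p c` is the component `c` if `p` holds, and the component `Z` otherwise. -/
abbrev delta (p : Prop) [Decidable p] (c : Comp) : Comp →₀ ℝ :=
  Finsupp.single (if p then c else Comp.Z) 1

/-! ### The one-particle operator -/

/-- Rank indices for the one-particle operator: the string of components on the sites to the left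
(in the left half) or to the right (in the right half) of the bond is the identity, contains one
annihilator at `j`, contains one creator at `i`, or represents all complete terms. -/
inductive Chan₁ (K : ℕ)
  | id
  | an (j : Fin K)
  | cr (i : Fin K)
  | done
  deriving Fintype

namespace Chan₁

variable {K : ℕ}

def liveL (b : ℕ) : Chan₁ K → Prop
  | id => True
  | an j => (j : ℕ) < b
  | cr i => (i : ℕ) < b
  | done => 1 ≤ b

def liveR (b : ℕ) : Chan₁ K → Prop
  | id => True
  | an j => b ≤ (j : ℕ)
  | cr i => b ≤ (i : ℕ)
  | done => b + 1 ≤ K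

/-- The number of particles that the string belonging to the index adds. -/
def charge : Chan₁ K → ℤ
  | id => 0
  | an _ => -1
  | cr _ => 1
  | done => 0

/-- The cores `T_k`, `k ≤ K/2`. -/
def coreL (t : Fin K → Fin K → ℝ) (k : Fin K) : Chan₁ K → Chan₁ K → Comp →₀ ℝ
  | id, id => entry .I 1
  | id, an j => delta (j = k) .A
  | id, cr i => delta (i = k) .Astar
  | id, done => entry .AstarA (t k k)
  | an j, an j' => delta (j = j') .S
  | an j, done => entry .Astar (t k j)
  | cr i, cr i' => delta (i = i') .S
  | cr i, done => entry .A (t i k)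
  | done, done => entry .I 1
  | _, _ => entry .Z 1

/-- The cores `T_k`, `k > K/2`. -/
def coreR (t : Fin K → Fin K → ℝ) (k : Fin K) : Chan₁ K → Chan₁ K → Comp →₀ ℝ
  | id, id => entry .I 1
  | an j, id => delta (j = k) .A
  | cr i, id => delta (i = k) .Astar
  | done, id => entry .AstarA (t k k)
  | an j, an j' => delta (j = j') .S
  | done, an j => entry .Astar (t k j)
  | cr i, cr i' => delta (i = i') .S
  | done, cr i => entry .A (t i k)
  | done, done => entry .I 1
  | _, _ => entry .Z 1

/-- The matrix `M_T` in the middle. -/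
def mid (t : Fin K → Fin K → ℝ) : Chan₁ K → Chan₁ K → ℝ
  | id, done => 1
  | an j, cr i => t i j
  | cr i, an j => t i j
  | done, id => 1
  | _, _ => 0

end Chan₁

/-- The representation `T_1 ⋈ ⋯ ⋈ T_{K/2} M_T ⋈ T_{K/2+1} ⋈ ⋯ ⋈ T_K` of the one-particle
operator. -/
def oneParticleMPO {K : ℕ} (t : Fin K → Fin K → ℝ) : SymbolicMPO K :=
  glue K Chan₁.liveL Chan₁.liveR (Chan₁.coreL t) (Chan₁.coreR t) (Chan₁.mid t)

/-- The representation `S_b` of the one-particle operator by block operations. To the left of a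
bond in the right half, the string to the right of the bond has been compensated for. -/
def oneParticleBlockMPO {K : ℕ} (t : Fin K → Fin K → ℝ) : BlockMPO K :=
  (oneParticleMPO t).toBlock fun b c => if (b : ℕ) < K / 2 then c.1.charge else -c.1.charge

/-! ### The two-particle operator -/

/-- The antisymmetrized coefficients `ṽ`, for which
`∑ v_{i₁ i₂ j₁ j₂} a_{i₁}^* a_{i₂}^* a_{j₁} a_{j₂} = ∑ ṽ_{i₁ i₂ j₁ j₂} a_{i₁}^* a_{i₂}^* a_{j₁} a_{j₂}`,
the second sum being over `i₁ < i₂` and `j₁ < j₂` only. -/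
def antisymCoeff {K : ℕ} (v : Fin K → Fin K → Fin K → Fin K → ℝ) (i₁ i₂ j₁ j₂ : Fin K) : ℝ :=
  if i₁ < i₂ ∧ j₁ < j₂ then
    v i₁ i₂ j₁ j₂ + v i₂ i₁ j₂ j₁ - v i₂ i₁ j₁ j₂ - v i₁ i₂ j₂ j₁
  else 0

/-- Rank indices for the two-particle operator: the string of components on the sites to the left
(in the left half) or to the right (in the right half) of the bond is the identity, contains the
indicated creators and annihilators (`ca`: one of each, `cc`: two creators, `aa`: two
annihilators), represents all terms that are complete except for an annihilator at `j` or for a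
creator at `i` on the other side of the bond, or represents all complete terms. -/
inductive Chan₂ (K : ℕ)
  | id
  | cr (i : Fin K)
  | an (j : Fin K)
  | ca (i j : Fin K)
  | cc (i₁ i₂ : Fin K)
  | aa (j₁ j₂ : Fin K)
  | needAn (j : Fin K)
  | needCr (i : Fin K)
  | done
  deriving Fintype

namespace Chan₂

variable {K : ℕ}

def liveL (b : ℕ) : Chan₂ K → Prop
  | id => True
  | cr i => (i : ℕ) < b
  | an j => (j : ℕ) < b
  | ca i j => (i : ℕ) < b ∧ (j : ℕ) < b
  | cc i₁ i₂ => i₁ < i₂ ∧ (i₂ : ℕ) < b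
  | aa j₁ j₂ => j₁ < j₂ ∧ (j₂ : ℕ) < b
  | needAn j => 2 ≤ b ∧ b ≤ (j : ℕ)
  | needCr i => 2 ≤ b ∧ b ≤ (i : ℕ)
  | done => 2 ≤ b

def liveR (b : ℕ) : Chan₂ K → Prop
  | id => True
  | cr i => b ≤ (i : ℕ)
  | an j => b ≤ (j : ℕ)
  | ca i j => b ≤ (i : ℕ) ∧ b ≤ (j : ℕ)
  | cc i₁ i₂ => i₁ < i₂ ∧ b ≤ (i₁ : ℕ)
  | aa j₁ j₂ => j₁ < j₂ ∧ b ≤ (j₁ : ℕ)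
  | needAn j => b + 2 ≤ K ∧ (j : ℕ) < b
  | needCr i => b + 2 ≤ K ∧ (i : ℕ) < b
  | done => b + 2 ≤ K

/-- The number of particles that the string belonging to the index adds. -/
def charge : Chan₂ K → ℤ
  | id => 0
  | cr _ => 1
  | an _ => -1
  | ca _ _ => 0
  | cc _ _ => 2
  | aa _ _ => -2
  | needAn _ => 1
  | needCr _ => -1
  | done => 0

/-- The cores `V_k`, `k ≤ K/2`, for coefficients `w`. -/
def coreL (w : Fin K → Fin K → Fin K → Fin K → ℝ) (k : Fin K) : Chan₂ K → Chan₂ K → Comp →₀ ℝ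
  | id, id => entry .I 1
  | id, cr i => delta (i = k) .Astar
  | id, an j => delta (j = k) .A
  | id, ca i j => delta (i = k ∧ j = k) .AstarA
  | cr i, cr i' => delta (i = i') .S
  | cr i, ca i' j => delta (i = i' ∧ j = k) .A
  | cr i, cc i₁ i₂ => delta (i = i₁ ∧ i₂ = k) .Astar
  | cr i, needAn j => entry .AstarA (w i k k j)
  | an j, an j' => delta (j = j') .S
  | an j, ca i j' => delta (j = j' ∧ i = k) .Astar
  | an j, aa j₁ j₂ => delta (j = j₁ ∧ j₂ = k) .A
  | an j, needCr i => entry .AstarA (w k i j k)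
  | ca i j, ca i' j' => delta (i = i' ∧ j = j') .I
  | ca i j, needAn j' => entry .Astar (w i k j j')
  | ca i j, needCr i' => entry .A (w i i' j k)
  | ca i j, done => entry .AstarA (w i k j k)
  | cc i₁ i₂, cc i₁' i₂' => delta (i₁ = i₁' ∧ i₂ = i₂') .I
  | cc i₁ i₂, needAn j => entry .A (w i₁ i₂ k j)
  | aa j₁ j₂, aa j₁' j₂' => delta (j₁ = j₁' ∧ j₂ = j₂') .I
  | aa j₁ j₂, needCr i => entry .Astar (w k i j₁ j₂)
  | needAn j, needAn j' => delta (j = j') .S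
  | needAn j, done => delta (j = k) .A
  | needCr i, needCr i' => delta (i = i') .S
  | needCr i, done => delta (i = k) .Astar
  | done, done => entry .I 1
  | _, _ => entry .Z 1

/-- The cores `V_k`, `k > K/2`, for coefficients `w`. -/
def coreR (w : Fin K → Fin K → Fin K → Fin K → ℝ) (k : Fin K) : Chan₂ K → Chan₂ K → Comp →₀ ℝ
  | id, id => entry .I 1
  | cr i, id => delta (i = k) .Astar
  | an j, id => delta (j = k) .A
  | ca i j, id => delta (i = k ∧ j = k) .AstarA
  | cr i, cr i' => delta (i = i') .S
  | ca i j, cr i' => delta (i = i' ∧ j = k) .A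
  | cc i₁ i₂, cr i => delta (i₁ = k ∧ i₂ = i) .Astar
  | needAn j, cr i => entry .AstarA (w k i j k)
  | an j, an j' => delta (j = j') .S
  | ca i j, an j' => delta (j = j' ∧ i = k) .Astar
  | aa j₁ j₂, an j => delta (j₁ = k ∧ j₂ = j) .A
  | needCr i, an j => entry .AstarA (w i k k j)
  | ca i j, ca i' j' => delta (i = i' ∧ j = j') .I
  | needCr i, ca i' j => entry .A (w i i' k j)
  | needAn j, ca i j' => entry .Astar (w k i j j')
  | done, ca i j => entry .AstarA (w k i k j)
  | cc i₁ i₂, cc i₁' i₂' => delta (i₁ = i₁' ∧ i₂ = i₂') .I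
  | needAn j, cc i₁ i₂ => entry .A (w i₁ i₂ j k)
  | aa j₁ j₂, aa j₁' j₂' => delta (j₁ = j₁' ∧ j₂ = j₂') .I
  | needCr i, aa j₁ j₂ => entry .Astar (w i k j₁ j₂)
  | needAn j, needAn j' => delta (j = j') .S
  | done, needAn j => delta (j = k) .A
  | needCr i, needCr i' => delta (i = i') .S
  | done, needCr i => delta (i = k) .Astar
  | done, done => entry .I 1
  | _, _ => entry .Z 1

/-- The matrix `M_V` in the middle, for coefficients `w`. -/
def mid (w : Fin K → Fin K → Fin K → Fin K → ℝ) : Chan₂ K → Chan₂ K → ℝ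
  | id, done => 1
  | cr i, needCr i' => if i = i' then 1 else 0
  | an j, needAn j' => if j = j' then 1 else 0
  | ca i₁ j₁, ca i₂ j₂ => w i₁ i₂ j₁ j₂
  | cc i₁ i₂, aa j₁ j₂ => w i₁ i₂ j₁ j₂
  | aa j₁ j₂, cc i₁ i₂ => w i₁ i₂ j₁ j₂
  | needAn j, an j' => if j = j' then 1 else 0
  | needCr i, cr i' => if i = i' then 1 else 0
  | done, id => 1
  | _, _ => 0

end Chan₂

/-- The representation `V_1 ⋈ ⋯ ⋈ V_{K/2} M_V ⋈ V_{K/2+1} ⋈ ⋯ ⋈ V_K` of the two-particle operator.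
The tensor product of the components belonging to `i₁ < i₂` and `j₁ < j₂` (components `A*`, `A`,
`A*A` at these sites, `S` or `I` elsewhere) is `a_{i₁}^* a_{i₂}^* a_{j₂} a_{j₁}`, which is
`-a_{i₁}^* a_{i₂}^* a_{j₁} a_{j₂}`, so that the coefficients are `-ṽ`. -/
def twoParticleMPO {K : ℕ} (v : Fin K → Fin K → Fin K → Fin K → ℝ) : SymbolicMPO K :=
  let w : Fin K → Fin K → Fin K → Fin K → ℝ := fun i₁ i₂ j₁ j₂ => -antisymCoeff v i₁ i₂ j₁ j₂
  glue K Chan₂.liveL Chan₂.liveR (Chan₂.coreL w) (Chan₂.coreR w) (Chan₂.mid w)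

/-- The representation `D_b` of the two-particle operator by block operations. -/
def twoParticleBlockMPO {K : ℕ} (v : Fin K → Fin K → Fin K → Fin K → ℝ) : BlockMPO K :=
  (twoParticleMPO v).toBlock fun b c => if (b : ℕ) < K / 2 then c.1.charge else -c.1.charge

end FockMPS

end

noncomputable section

namespace FockMPS

/-! ### Evaluation of symbolic entries -/

/-! The statement combines two independent facts.

Restriction to admissible blocks loses nothing. Each component changes the occupation of its site by
a fixed amount, and the shifts of the rank indices record exactly these changes (`ShiftConsistent`).
Hence an entry of the ordinary product core between `(m, j)` and `(m', j')` vanishes unless label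
plus shift grows by the occupation of the site (`label_of_productCore_ne_zero`); this is block
sparsity. Along a path that contributes to the tensor, label plus shift runs from `0` to `N` in
steps `0` or `1`, so it lies in `𝒦_k` at every bond (`mem_occRange_of_steps`). The removed indices
therefore contribute nothing, and the tensor is the operator matrix applied to `τ(X)`
(`apply_tensor`).

The symbolic representation denotes the right matrix. A product of creators at `C` and annihilators
at `D` is, up to sign, a string: a Kronecker product with `A*`, `A`, `A*A` at these sites and `I` or
`S` elsewhere, according to the parity of the number of operators on one side. For an even total
number the parity is the same from both sides (`siteComp_gt`), so the string factors at the middle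
into a left and a right part, read in opposite orders (`str_join`). Each rank index stands for an
explicit weighted sum of partial strings (`closedForm`), and one core turns the sums for a set of
sites into those for one more site (`closedForm_step`). Right cores are left cores transposed, so
the same lemma with the order reversed serves the right half. `glue_matrix` joins the two halves;
the blocks of the middle matrix are the ways of distributing the operators over them. For two
particles, anticommutation first reduces the operator to `i₁ < i₂`, `j₁ < j₂`
(`twoParticleOp_apply`). -/

/-- The entry at `(x, y)` of the `2 × 2` matrix denoted by a linear combination of components. -/
def ev (x y : Fin 2) : (Comp →₀ ℝ) →ₗ[ℝ] ℝ :=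
  Finsupp.linearCombination ℝ fun c => c.toMatrix x y

lemma ev_single (x y : Fin 2) (c : Comp) (a : ℝ) :
    ev x y (Finsupp.single c a) = a * c.toMatrix x y := by
  simp [ev]

lemma ev_eq_sum (x y : Fin 2) (f : Comp →₀ ℝ) :
    ev x y f = f.sum fun c a => a * c.toMatrix x y := by
  simp [ev, Finsupp.linearCombination_apply]

/-- The matrix entry of the operator denoted by a symbolic matrix product operator. -/
def SymbolicMPO.matrix {K : ℕ} (T : SymbolicMPO K) :
    Matrix (Fin K → Fin 2) (Fin K → Fin 2) ℝ :=
  fun α β => ∑ m : (∀ k : Fin (K + 1), T.Bond k),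
    ∏ k : Fin K, ev (α k) (β k) (T.core k (m k.castSucc) (m k.succ))

/-- Shifts are consistent if every component in an entry changes the particle number by the
difference of the shifts of its column and its row. -/
def SymbolicMPO.ShiftConsistent {K : ℕ} (T : SymbolicMPO K) (shift : ∀ k, T.Bond k → ℤ) : Prop :=
  ∀ k m m' c, T.core k m m' c ≠ 0 → ∀ x y : Fin 2, c.toMatrix x y ≠ 0 →
    shift k.succ m' + (y : ℕ) = shift k.castSucc m + (x : ℕ)

/-! ### Block operations act like components -/

lemma MPS.IsBlockSparse.label_succ {K N : ℕ} {X : MPS K} (hX : X.IsBlockSparse N) {k : Fin K}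
    {i : X.Bond k.castSucc} {j : X.Bond k.succ} {y : Fin 2} (h : X.core k i y j ≠ 0) :
    X.label k.succ j = X.label k.castSucc i + (y : ℕ) := by
  fin_cases y
  · simpa using hX.unocc_support k i j h
  · simpa using hX.occ_support k i j h

lemma MPS.IsBlockSparse.blocks_unocc {K N : ℕ} {X : MPS K} (hX : X.IsBlockSparse N) (k : Fin K)
    (n : ℤ) (i : X.Bond k.castSucc) (j : X.Bond k.succ) :
    (X.blocks k).unocc n i j = if X.label k.castSucc i = n then X.core k i 0 j else 0 := by
  by_cases h : X.core k i 0 j = 0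
  · simp [MPS.blocks, h]
  · have := hX.unocc_support k i j h
    simp only [MPS.blocks, this, and_self]

lemma MPS.IsBlockSparse.blocks_occ {K N : ℕ} {X : MPS K} (hX : X.IsBlockSparse N) (k : Fin K)
    (n : ℤ) (i : X.Bond k.castSucc) (j : X.Bond k.succ) :
    (X.blocks k).occ n i j = if X.label k.castSucc i = n then X.core k i 1 j else 0 := by
  by_cases h : X.core k i 1 j = 0
  · simp [MPS.blocks, h]
  · have := hX.occ_support k i j h
    simp only [MPS.blocks, this, add_left_inj, and_self]

/-- The row label determines the only block number that can contribute, and block sparsity makes the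
condition on the column label redundant. What remains is the matrix of the component acting on the
site, subject to the admissibility test for that one block. -/
lemma MPS.IsBlockSparse.layer_act {K N : ℕ} {X : MPS K} (hX : X.IsBlockSparse N) (k : Fin K)
    (o : BlockOp) (x : Fin 2) (i : X.Bond k.castSucc) (j : X.Bond k.succ) :
    (o.act (X.blocks k)).layer K N k x i j =
      if X.label k.castSucc i + o.shift ∈ occRange K N k ∧
          X.label k.castSucc i + o.shift + (x : ℕ) ∈ occRange K N (k + 1) then
        ∑ y, o.comp.toMatrix x y * X.core k i y j else 0 := by
  obtain ⟨c, s⟩ := o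
  -- `X.label i = n - s` has the single solution `n = X.label i + s`, so the sum over blocks
  -- collapses.
  have key : ∀ (p : ℤ → Prop) [DecidablePred p] (a : ℝ),
      (∑ n ∈ occRange K N k with p n, if X.label k.castSucc i = n - s then a else 0) =
        if X.label k.castSucc i + s ∈ occRange K N k ∧ p (X.label k.castSucc i + s)
          then a else 0 := by
    intro p _ a
    have : ∀ n : ℤ, (X.label k.castSucc i = n - s) ↔ (X.label k.castSucc i + s = n) := by
      intro n; omega
    simp only [this, Finset.sum_ite_eq, Finset.mem_filter]
  cases c <;> fin_cases x <;>
    simp [BlockCore.layer, BlockOp.act, Comp.toMatrix, Matrix.sum_apply, hX.blocks_unocc,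
      hX.blocks_occ, key, Matrix.one_apply]
  split_ifs <;> simp

/-! ### Mode core product with a block-sparse state -/

section Apply

variable {K N : ℕ} {T : SymbolicMPO K} {shift : ∀ k, T.Bond k → ℤ} {X : MPS K}

/-- The core entries of the unrestricted product of an operator and a tensor representation. -/
def productCore (T : SymbolicMPO K) (X : MPS K) (k : Fin K) (p : T.Bond k.castSucc × X.Bond k.castSucc)
    (x : Fin 2) (q : T.Bond k.succ × X.Bond k.succ) : ℝ :=
  ∑ y, ev x y (T.core k p.1 q.1) * X.core k p.2 y q.2

/-- A nonzero entry contains a nonzero product of a component entry `(x, y)` and a state entry with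
occupation `y`. The first changes the shift by `x - y`, the second changes the label by `y`, and the
sum is `x`. -/
lemma label_of_productCore_ne_zero (hX : X.IsBlockSparse N) (hT : T.ShiftConsistent shift)
    {k : Fin K} {p : T.Bond k.castSucc × X.Bond k.castSucc} {x : Fin 2}
    {q : T.Bond k.succ × X.Bond k.succ} (h : productCore T X k p x q ≠ 0) :
    X.label k.succ q.2 + shift k.succ q.1 =
      X.label k.castSucc p.2 + shift k.castSucc p.1 + (x : ℕ) := by
  obtain ⟨y, -, hy⟩ := Finset.exists_ne_zero_of_sum_ne_zero h
  obtain ⟨h1, h2⟩ := ne_zero_and_ne_zero_of_mul hy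
  rw [ev_eq_sum] at h1
  obtain ⟨c, hc, h3⟩ := Finset.exists_ne_zero_of_sum_ne_zero h1
  have h4 := hT k p.1 q.1 c (by simpa using hc) x y (right_ne_zero_of_mul h3)
  have h5 := hX.label_succ h2
  omega

/-- Pairs of rank indices that are kept in the mode core product. -/
abbrev keptPairs (T : SymbolicMPO K) (shift : ∀ k, T.Bond k → ℤ) (N : ℕ) (X : MPS K)
    (b : Fin (K + 1)) : Type :=
  {p : T.Bond b × X.Bond b // X.label b p.2 + shift b p.1 ∈ occRange K N b}

/-- Between two kept pairs the deletion of inadmissible blocks has no effect: the row and column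
tests are the conditions for keeping `p` and `q`. -/
lemma apply_core (hX : X.IsBlockSparse N) (hT : T.ShiftConsistent shift) (k : Fin K)
    (p : keptPairs T shift N X k.castSucc) (x : Fin 2) (q : keptPairs T shift N X k.succ) :
    ((T.toBlock shift).apply N X).core k p x q = productCore T X k p.1 x q.1 := by
  have hp := p.2
  have hq := q.2
  have h0 : ((T.toBlock shift).apply N X).core k p x q =
      (T.core k p.1.1 q.1.1).sum fun c a =>
        a * ((⟨c, shift k.castSucc p.1.1⟩ : BlockOp).act (X.blocks k)).layer K N k x p.1.2 q.1.2 := by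
    change ((T.core k p.1.1 q.1.1).mapDomain fun c => (⟨c, shift k.castSucc p.1.1⟩ : BlockOp)).sum
      (fun o c => c * (o.act (X.blocks k)).layer K N k x p.1.2 q.1.2) = _
    rw [Finsupp.sum_mapDomain_index]
    · intro; simp
    · intros; ring
  rw [h0]
  simp only [productCore, ev_eq_sum, Finsupp.sum, Finset.sum_mul]
  rw [Finset.sum_comm]
  refine Finset.sum_congr rfl fun c hc => ?_
  rw [hX.layer_act]
  simp only [mul_assoc, ← Finset.mul_sum]
  congr 1
  split_ifs with h
  · rfl
  · symm
    refine Finset.sum_eq_zero fun y _ => ?_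
    -- A nonzero term would make the row value plus `x` equal to the column value, which is
    -- admissible because `q` is kept.
    by_contra hy
    obtain ⟨h1, h2⟩ := ne_zero_and_ne_zero_of_mul hy
    have h4 := hT k p.1.1 q.1.1 c (by simpa using hc) x y h1
    have h5 := hX.label_succ h2
    refine h ⟨hp, ?_⟩
    have h6 : X.label k.castSucc p.1.2 + shift k.castSucc p.1.1 + (x : ℕ) =
        X.label k.succ q.1.2 + shift k.succ q.1.1 := by omega
    have h7 : X.label k.succ q.1.2 + shift k.succ q.1.1 ∈ occRange K N (k + 1) := hq
    rwa [← h6] at h7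

theorem apply_isBlockSparse (hX : X.IsBlockSparse N) (hT : T.ShiftConsistent shift) (hN : N ≤ K)
    (c0 : Fintype.card (T.Bond 0) = 1) (cK : Fintype.card (T.Bond (Fin.last K)) = 1)
    (s0 : ∀ m, shift 0 m = 0) (sK : ∀ m, shift (Fin.last K) m = 0) :
    ((T.toBlock shift).apply N X).IsBlockSparse N := by
  have hcard : ∀ b, (∀ p : T.Bond b × X.Bond b,
        X.label b p.2 + shift b p.1 ∈ occRange K N b) →
      Fintype.card (T.Bond b) = 1 → Fintype.card (X.Bond b) = 1 →
      Fintype.card (((T.toBlock shift).apply N X).Bond b) = 1 := by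
    intro b h h1 h2
    have e : ((T.toBlock shift).apply N X).Bond b ≃ T.Bond b × X.Bond b :=
      Equiv.subtypeUnivEquiv h
    rw [Fintype.card_congr e, Fintype.card_prod, h1, h2]
  refine ⟨hcard 0 ?_ c0 hX.card_first, hcard _ ?_ cK hX.card_last, ?_, ?_, fun k p => p.2, ?_, ?_⟩
  · intro p
    rw [hX.label_first, s0]
    simp [occRange, hN]
  · intro p
    rw [hX.label_last, sK]
    simp [occRange, hN]
  · rintro ⟨⟨m, j⟩, hp⟩
    exact (congrArg₂ (· + ·) (hX.label_first j) (s0 m)).trans (add_zero _)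
  · rintro ⟨⟨m, j⟩, hp⟩
    exact (congrArg₂ (· + ·) (hX.label_last j) (sK m)).trans (add_zero _)
  · intro k (p : keptPairs T shift N X _) (q : keptPairs T shift N X _) h
    have h' : productCore T X k p.1 0 q.1 ≠ 0 := fun h0 =>
      h ((apply_core hX hT k p 0 q).trans h0)
    exact (label_of_productCore_ne_zero hX hT h').trans (by simp; rfl)
  · intro k (p : keptPairs T shift N X _) (q : keptPairs T shift N X _) h
    have h' : productCore T X k p.1 1 q.1 ≠ 0 := fun h0 =>
      h ((apply_core hX hT k p 1 q).trans h0)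
    exact (label_of_productCore_ne_zero hX hT h').trans (by simp; rfl)

/-- Along a path of `0`-`1` steps from `0` to `N`, all values are admissible particle numbers. -/
lemma mem_occRange_of_steps (l : Fin (K + 1) → ℤ) (x : Fin K → Fin 2) (h0 : l 0 = 0)
    (hl : l (Fin.last K) = N) (hs : ∀ k : Fin K, l k.succ = l k.castSucc + (x k : ℕ))
    (b : Fin (K + 1)) : l b ∈ occRange K N b := by
  have hx : ∀ k : Fin K, ((x k : ℕ) : ℤ) ≤ 1 := fun k => by have := (x k).2; omega
  have h1 : 0 ≤ l b ∧ l b ≤ (b : ℕ) := by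
    induction b using Fin.induction with
    | zero => simp [h0]
    | succ k ih => have := hs k; have := hx k; simp at ih ⊢; omega
  -- The bounds involving `N` come from the right end, by induction downwards from bond `K`.
  have h2 : l b ≤ N ∧ (N : ℤ) - K + (b : ℕ) ≤ l b := by
    induction b using Fin.reverseInduction with
    | last => simp [hl]
    | cast k ih =>
      have h3 : 0 ≤ l k.succ ∧ l k.succ ≤ (k.succ : ℕ) := by
        have := hs k; have := hx k; simp at h1 ⊢; omega
      have := ih h3; have := hs k; have := hx k; simp at *; omega
  simp [occRange]; omega

/-- The sum over kept paths is first extended to all paths of pairs, the additional ones having a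
vanishing factor. The unrestricted sum then separates into paths of the operator and paths of the
state. -/
theorem apply_tensor (hX : X.IsBlockSparse N) (hT : T.ShiftConsistent shift)
    (s0 : ∀ m, shift 0 m = 0) (sK : ∀ m, shift (Fin.last K) m = 0) :
    ((T.toBlock shift).apply N X).tensor = T.matrix.mulVec X.tensor := by
  classical
  funext α
  let good : ∀ b, T.Bond b × X.Bond b → Prop := fun b p =>
    X.label b p.2 + shift b p.1 ∈ occRange K N b
  let F : (∀ b, T.Bond b × X.Bond b) → ℝ := fun p =>
    ∏ k : Fin K, productCore T X k (p k.castSucc) (α k) (p k.succ)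
  have h1 : ((T.toBlock shift).apply N X).tensor α =
      ∑ p : (∀ b, {p : T.Bond b × X.Bond b // good b p}), F fun b => (p b).1 := by
    exact Finset.sum_congr rfl fun p _ => Finset.prod_congr rfl fun k _ =>
      apply_core hX hT k (p k.castSucc) (α k) (p k.succ)
  have h2 : ∑ p : (∀ b, {p : T.Bond b × X.Bond b // good b p}), F (fun b => (p b).1) =
      ∑ p : {p : (∀ b, T.Bond b × X.Bond b) // ∀ b, good b (p b)}, F p.1 := by
    symm
    exact Fintype.sum_equiv Equiv.subtypePiEquivPi _ _ fun p => rfl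
  have h3 : ∑ p : {p : (∀ b, T.Bond b × X.Bond b) // ∀ b, good b (p b)}, F p.1 = ∑ p, F p := by
    rw [← Finset.sum_subtype (Finset.univ.filter fun p => ∀ b, good b (p b)) (by simp) F]
    refine Finset.sum_filter_of_ne fun p _ hp => ?_
    have hne : ∀ k : Fin K, productCore T X k (p k.castSucc) (α k) (p k.succ) ≠ 0 := fun k =>
      Finset.prod_ne_zero_iff.1 hp k (Finset.mem_univ k)
    exact mem_occRange_of_steps (fun b => X.label b (p b).2 + shift b (p b).1) α
      (by simp [hX.label_first, s0]) (by simp [hX.label_last, sK])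
      fun k => label_of_productCore_ne_zero hX hT (hne k)
  have h4 : ∑ p, F p = ∑ m : (∀ b, T.Bond b), ∑ j : (∀ b, X.Bond b), F fun b => (m b, j b) := by
    rw [← Fintype.sum_prod_type']
    exact Fintype.sum_equiv (Equiv.arrowProdEquivProdArrow _ _ _) _ _ fun p => rfl
  rw [h1, h2, h3, h4]
  -- Expanding the product over sites of the sums over `y` produces the sum over column
  -- multi-indices in the matrix-vector product.
  simp only [F, productCore, Fintype.prod_sum, Finset.prod_mul_distrib]
  simp only [Matrix.mulVec, dotProduct, SymbolicMPO.matrix, MPS.tensor, Finset.sum_mul_sum]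
  rw [Finset.sum_congr rfl fun m _ => Finset.sum_comm, Finset.sum_comm]

end Apply

/-! ### Sums over paths of rank indices -/

/-- The sum over all paths, evaluated by multiplying the cores from the left. -/
lemma sum_paths_eq {n : ℕ} (B : Fin (n + 1) → Type) [∀ b, Fintype (B b)]
    (f : ∀ k : Fin n, B k.castSucc → B k.succ → ℝ) (V : ∀ b, B b → ℝ)
    (hV : ∀ k m', V (Fin.succ k) m' = ∑ m, V k.castSucc m * f k m m') :
    ∑ p : (∀ b, B b), V 0 (p 0) * ∏ k, f k (p k.castSucc) (p k.succ) =
      ∑ m, V (Fin.last n) m := by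
  classical
  induction n with
  | zero =>
    rw [← (Fin.consEquiv B).sum_comp, Fintype.sum_prod_type]
    simp
  | succ n ih =>
    rw [← (Fin.consEquiv B).sum_comp, Fintype.sum_prod_type_right]
    -- The first core is contracted into the vector at bond `1`, which becomes the initial vector of
    -- the remaining chain.
    have h := ih (fun b => B b.succ) (fun k => f k.succ) (fun b => V b.succ) fun k m' => hV k.succ m'
    refine Eq.trans ?_ h
    refine Finset.sum_congr rfl fun p _ => ?_
    have h1 := hV 0 (p 0)
    change _ = V (Fin.succ 0) (p 0) * _
    rw [h1, Finset.sum_mul]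
    refine Finset.sum_congr rfl fun m _ => ?_
    rw [Fin.prod_univ_succ, mul_assoc]
    rfl

lemma sum_subtype_eq {Γ : Type} [Fintype Γ] {p : Γ → Prop} [Fintype {c // p c}] (g : Γ → ℝ)
    (h : ∀ c, ¬ p c → g c = 0) : ∑ m : {c // p c}, g m.1 = ∑ c, g c := by
  classical
  rw [← Finset.sum_subtype (Finset.univ.filter p) (by simp) g]
  exact Finset.sum_filter_of_ne fun c _ hc => by by_contra h'; exact hc (h c h')

/-! ### Evaluation of a glued operator from both ends -/

section Glue

variable {Γ : Type} [Fintype Γ] {K : ℕ} {liveL liveR : ℕ → Γ → Prop}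
  {L R : Fin K → Γ → Γ → Comp →₀ ℝ} {M : Γ → Γ → ℝ}

/-- `l` and `r` are proposed values of the partial products from the left and right ends. The
recursions are needed only at live indices; vanishing at the others allows every sum over a bond to
be taken over all of `Γ`. The two recursions meet at bond `K / 2`, where the last left core has
absorbed `M`. -/
theorem glue_matrix (h0 : 0 < K / 2) (α β : Fin K → Fin 2) (l r : ℕ → Γ → ℝ)
    (l_zero : ∀ c, liveL 0 c → l 0 c = 1) (r_last : ∀ c, liveR K c → r K c = 1)
    (l_live : ∀ b c, ¬ liveL b c → l b c = 0) (r_live : ∀ b c, ¬ liveR b c → r b c = 0)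
    (l_rec : ∀ (k : Fin K) c, liveL (k + 1) c →
      ∑ m, l k m * ev (α k) (β k) (L k m c) = l (k + 1) c)
    (r_rec : ∀ (k : Fin K) c, liveR k c →
      ∑ m, ev (α k) (β k) (R k c m) * r (k + 1) m = r k c) :
    (glue K liveL liveR L R M).matrix α β =
      ∑ c, ∑ c', l (K / 2) c * M c c' * r (K / 2) c' := by
  classical
  set T := glue K liveL liveR L R M with hT
  let f : ∀ k : Fin K, T.Bond k.castSucc → T.Bond k.succ → ℝ :=
    fun k m m' => ev (α k) (β k) (T.core k m m')
  -- `V b` is the actual partial product from the left, to be compared with `l` before the middle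
  -- and paired with `r` from the middle on.
  let V : ∀ b, T.Bond b → ℝ := fun b => Fin.induction (motive := fun b => T.Bond b → ℝ)
    (fun _ => 1) (fun k v m' => ∑ m, v m * f k m m') b
  have V0 : ∀ m, V 0 m = 1 := fun m => rfl
  have hV : ∀ k m', V (Fin.succ k) m' = ∑ m, V k.castSucc m * f k m m' := fun k m' => rfl
  have hpath : T.matrix α β = ∑ m, V (Fin.last K) m := by
    rw [← sum_paths_eq T.Bond f V hV]
    simp only [V0, one_mul]
    rfl
  obtain ⟨val, hval⟩ : ∃ val : ∀ b, T.Bond b → Γ, val = fun b m => Subtype.val m := ⟨_, rfl⟩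
  have liveL_val : ∀ b : Fin (K + 1), (b : ℕ) < K / 2 → ∀ m, liveL b (val b m) := by
    intro b hb m
    have h : if (b : ℕ) < K / 2 then liveL b m.1 else liveR b m.1 := m.2
    rw [if_pos hb] at h
    rwa [hval]
  have liveR_val : ∀ b : Fin (K + 1), K / 2 ≤ (b : ℕ) → ∀ m, liveR b (val b m) := by
    intro b hb m
    have h : if (b : ℕ) < K / 2 then liveL b m.1 else liveR b m.1 := m.2
    rw [if_neg hb.not_gt] at h
    rwa [hval]
  have sumL : ∀ b : Fin (K + 1), (b : ℕ) < K / 2 → ∀ g : Γ → ℝ, (∀ c, ¬ liveL b c → g c = 0) →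
      ∑ m, g (val b m) = ∑ c, g c := by
    intro b hb g hg
    rw [hval]
    exact sum_subtype_eq g fun c hc => hg c (by rwa [if_pos hb] at hc)
  have sumR : ∀ b : Fin (K + 1), K / 2 ≤ (b : ℕ) → ∀ g : Γ → ℝ, (∀ c, ¬ liveR b c → g c = 0) →
      ∑ m, g (val b m) = ∑ c, g c := by
    intro b hb g hg
    rw [hval]
    exact sum_subtype_eq g fun c hc => hg c (by rwa [if_neg hb.not_gt] at hc)
  have coreL : ∀ (k : Fin K) m m', (k : ℕ) + 1 < K / 2 →
      f k m m' = ev (α k) (β k) (L k (val _ m) (val _ m')) := by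
    intro k m m' hk
    rw [hval]
    exact congrArg (ev (α k) (β k)) (if_pos hk)
  have coreM : ∀ (k : Fin K) m m', (k : ℕ) + 1 = K / 2 →
      f k m m' = ev (α k) (β k)
        (∑ c : Γ with liveL (k + 1) c, M c (val _ m') • L k (val _ m) c) := by
    intro k m m' hk
    rw [hval]
    exact congrArg (ev (α k) (β k)) ((if_neg (by omega)).trans (if_pos hk))
  have coreR : ∀ (k : Fin K) m m', K / 2 < (k : ℕ) + 1 →
      f k m m' = ev (α k) (β k) (R k (val _ m) (val _ m')) := by
    intro k m m' hk
    rw [hval]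
    exact congrArg (ev (α k) (β k)) ((if_neg (by omega)).trans (if_neg (by omega)))
  clear_value V f
  have hleft : ∀ b : Fin (K + 1), (b : ℕ) < K / 2 → ∀ m, V b m = l b (val b m) := by
    intro b
    induction b using Fin.induction with
    | zero => intro hb m; rw [V0]; exact (l_zero _ (liveL_val 0 hb m)).symm
    | succ k ih =>
      intro hb m
      have hk : (k : ℕ) + 1 < K / 2 := hb
      have hk' : ((k.castSucc : Fin (K + 1)) : ℕ) < K / 2 := by simp; omega
      simp only [hV, ih hk', coreL k _ m hk]
      rw [sumL _ hk' fun c => l k.castSucc c * ev (α k) (β k) (L k c (val _ m))]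
      · exact l_rec k _ (liveL_val _ hb m)
      · intro c hc
        rw [l_live _ _ hc, zero_mul]
  have hmid : ∀ b : Fin (K + 1), (b : ℕ) = K / 2 →
      ∀ m, V b m = ∑ c, l (K / 2) c * M c (val b m) := by
    intro b hb m
    obtain ⟨k, rfl⟩ : ∃ k : Fin K, b = k.succ :=
      ⟨⟨b - 1, by omega⟩, by ext; simp; omega⟩
    have hk : (k : ℕ) + 1 = K / 2 := hb
    have hk' : ((k.castSucc : Fin (K + 1)) : ℕ) < K / 2 := by simp; omega
    simp only [hV, hleft _ hk', coreM k _ m hk]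
    rw [sumL _ hk' fun a => l k.castSucc a * ev (α k) (β k)
      (∑ c : Γ with liveL (k + 1) c, M c (val _ m) • L k a c)]
    · simp only [map_sum, Finset.sum_filter, Finset.mul_sum]
      rw [Finset.sum_comm]
      refine Finset.sum_congr rfl fun c _ => ?_
      rw [← hk]
      split_ifs with hc
      · rw [← l_rec k c hc, Finset.sum_mul]
        exact Finset.sum_congr rfl fun a _ => by
          rw [LinearMap.map_smul (ev (α k) (β k)), smul_eq_mul, Fin.val_castSucc]
          ring
      · simp [l_live _ _ hc]
    · intro c hc
      rw [l_live _ _ hc, zero_mul]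
  -- The pairing of `V b` with `r b` does not depend on `b` in the right half, since a step moves
  -- one core `R k` from one factor to the other. At `K / 2` it is the claimed sum, at `K` it is the
  -- sum of `V`.
  have hright : ∀ b : Fin (K + 1), K / 2 ≤ (b : ℕ) →
      ∑ m, V b m * r b (val b m) = ∑ c, ∑ c', l (K / 2) c * M c c' * r (K / 2) c' := by
    have hbase : ∀ b : Fin (K + 1), (b : ℕ) = K / 2 →
        ∑ m, V b m * r b (val b m) = ∑ c, ∑ c', l (K / 2) c * M c c' * r (K / 2) c' := by
      intro b hb
      simp only [hmid b hb]
      rw [sumR b hb.ge fun c' => (∑ c, l (K / 2) c * M c c') * r b c', Finset.sum_comm]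
      · simp only [Finset.sum_mul, hb]
      · intro c hc
        rw [r_live _ _ hc, mul_zero]
    intro b
    induction b using Fin.induction with
    | zero => intro hb; exact hbase _ (by simp at hb ⊢; omega)
    | succ k ih =>
      intro hb
      rcases hb.eq_or_lt with hb' | hb'
      · exact hbase _ hb'.symm
      have hk : K / 2 < (k : ℕ) + 1 := hb'
      have hk' : K / 2 ≤ ((k.castSucc : Fin (K + 1)) : ℕ) := by simp; omega
      rw [← ih hk']
      simp only [hV, Finset.sum_mul, coreR k _ _ hk]
      rw [Finset.sum_comm]
      refine Finset.sum_congr rfl fun m0 _ => ?_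
      have h1 := r_rec k _ (liveR_val _ hk' m0)
      simp only [mul_assoc, ← Finset.mul_sum]
      rw [sumR k.succ hb fun c => ev (α k) (β k) (R k (val _ m0) c) * r k.succ c]
      · congr 1
      · intro c hc
        rw [r_live _ _ hc, mul_zero]
  rw [hpath, ← hright (Fin.last K) (by simp; omega)]
  refine Finset.sum_congr rfl fun m _ => ?_
  have hm := liveR_val (Fin.last K) (by simp; omega) m
  rw [show r (Fin.last K : Fin (K + 1)) (val _ m) = 1 from r_last _ hm, mul_one]

end Glue

/-! ### Strings of components

The strings are described with respect to a strict order `r` of the sites, which is `<` for the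
left and `>` for the right half; `s` is the set of the sites that have been processed. -/

/-- The entry of a component at site `k`. -/
def site {K : ℕ} (α β : Fin K → Fin 2) (c : Comp) (k : Fin K) : ℝ := c.toMatrix (α k) (β k)

open Classical in
/-- The component at site `k` of the string with creators at `C` and annihilators at `D`. -/
def siteComp {K : ℕ} (r : Fin K → Fin K → Prop) (C D : Finset (Fin K)) (k : Fin K) : Comp :=
  if k ∈ C then (if k ∈ D then .AstarA else .Astar)
  else if k ∈ D then .A
  else if Even ((C.filter fun x => r x k).card + (D.filter fun x => r x k).card) then .I else .S

/-- The entry of the part of a string that belongs to the sites in `s`. -/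
def str {K : ℕ} (α β : Fin K → Fin 2) (r : Fin K → Fin K → Prop) (C D s : Finset (Fin K)) : ℝ :=
  ∏ k ∈ s, site α β (siteComp r C D k) k

lemma ev_single_site {K : ℕ} (α β : Fin K → Fin 2) (k : Fin K) (c : Comp) (a : ℝ) :
    ev (α k) (β k) (Finsupp.single c a) = a * site α β c k := ev_single _ _ _ _

lemma site_Z {K : ℕ} (α β : Fin K → Fin 2) (k : Fin K) : site α β .Z k = 0 := by
  simp [site, Comp.toMatrix]

lemma site_ite {K : ℕ} (α β : Fin K → Fin 2) (k : Fin K) (p : Prop) [Decidable p] (c : Comp) :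
    site α β (if p then c else .Z) k = if p then site α β c k else 0 := by
  split_ifs <;> simp [site_Z]

section Strings

variable {K : ℕ} {α β : Fin K → Fin 2} {r : Fin K → Fin K → Prop} {s : Finset (Fin K)}
  {k : Fin K}

/-- A part of a string depends only on the operators in that part. -/
lemma str_congr {C C' D D' : Finset (Fin K)} (hs : ∀ y ∈ s, ∀ x, r x y → x ∈ s)
    (hC : ∀ x ∈ s, x ∈ C ↔ x ∈ C') (hD : ∀ x ∈ s, x ∈ D ↔ x ∈ D') :
    str α β r C D s = str α β r C' D' s := by
  classical
  refine Finset.prod_congr rfl fun y hy => ?_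
  have h1 : (C.filter fun x => r x y) = C'.filter fun x => r x y := by
    ext x; simp only [Finset.mem_filter]
    exact ⟨fun h => ⟨(hC x (hs y hy x h.2)).1 h.1, h.2⟩, fun h => ⟨(hC x (hs y hy x h.2)).2 h.1, h.2⟩⟩
  have h2 : (D.filter fun x => r x y) = D'.filter fun x => r x y := by
    ext x; simp only [Finset.mem_filter]
    exact ⟨fun h => ⟨(hD x (hs y hy x h.2)).1 h.1, h.2⟩, fun h => ⟨(hD x (hs y hy x h.2)).2 h.1, h.2⟩⟩
  simp only [siteComp, hC y hy, hD y hy]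
  congr! 7

variable [IsStrictOrder (Fin K) r]

/-- Processing site `k`, the sites before `k` having been processed. -/
structure Step (r : Fin K → Fin K → Prop) (s : Finset (Fin K)) (k : Fin K) : Prop where
  mem_iff : ∀ x, x ∈ s ↔ r x k

variable (h : Step r s k)
include h

lemma Step.notMem : k ∉ s := fun hk => irrefl k ((h.mem_iff k).1 hk)

lemma Step.lower : ∀ y ∈ s, ∀ x, r x y → x ∈ s := fun y hy _ hx =>
  (h.mem_iff _).2 (_root_.trans hx ((h.mem_iff y).1 hy))

lemma Step.ne {x : Fin K} (hx : x ∈ s) : x ≠ k := fun e => h.notMem (e ▸ hx)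

lemma Step.not_rel {x : Fin K} (hx : x ∈ insert k s) : ¬ r k x := by
  intro hr
  rcases Finset.mem_insert.1 hx with rfl | hx
  · exact irrefl _ hr
  · exact irrefl _ (_root_.trans hr ((h.mem_iff x).1 hx))

lemma Step.str_insert (C D : Finset (Fin K)) :
    str α β r C D (insert k s) = str α β r C D s * site α β (siteComp r C D k) k := by
  rw [str, Finset.prod_insert h.notMem, mul_comm]; rfl

/-- All operators precede `k`, so the parity at `k` is that of their total number. -/
lemma Step.str_pass {C D : Finset (Fin K)} (hC : C ⊆ s) (hD : D ⊆ s) :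
    str α β r C D (insert k s) =
      str α β r C D s * site α β (if Even (C.card + D.card) then .I else .S) k := by
  classical
  rw [h.str_insert, siteComp, if_neg fun hk => h.notMem (hC hk),
    if_neg fun hk => h.notMem (hD hk), Finset.filter_true_of_mem fun x hx => (h.mem_iff x).1 (hC hx),
    Finset.filter_true_of_mem fun x hx => (h.mem_iff x).1 (hD hx)]

/-- Used when an operator sits at `k` itself: `C'` and `D'` are then what is left of `C` and `D` on
the sites before `k`. -/
lemma Step.str_add {C D C' D' : Finset (Fin K)} {c : Comp} (hC : ∀ x ∈ s, x ∈ C ↔ x ∈ C')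
    (hD : ∀ x ∈ s, x ∈ D ↔ x ∈ D') (hc : siteComp r C D k = c) :
    str α β r C D (insert k s) = str α β r C' D' s * site α β c k := by
  rw [h.str_insert, hc, str_congr h.lower hC hD]

/-- Sums over pairs with first entry before the second one. -/
lemma Step.sum_pairs (f : Fin K → Fin K → ℝ) (hf : ∀ i j, ¬ r i j → f i j = 0) :
    ∑ i ∈ insert k s, ∑ j ∈ insert k s, f i j =
      (∑ i ∈ s, ∑ j ∈ s, f i j) + ∑ i ∈ s, f i k := by
  rw [Finset.sum_insert h.notMem, Finset.sum_eq_zero fun j hj => hf k j (h.not_rel hj), zero_add,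
    ← Finset.sum_add_distrib]
  exact Finset.sum_congr rfl fun i _ => by rw [Finset.sum_insert h.notMem, add_comm]

end Strings

/-! ### Closed forms: one-particle operator -/

namespace Chan₁

variable {K : ℕ}

lemma sum_eq (g : Chan₁ K → ℝ) :
    ∑ m, g m = g id + ∑ j, g (an j) + ∑ i, g (cr i) + g done := by
  rw [← (Chan₁.proxyTypeEquiv K).sum_comp]
  simp only [Fintype.sum_sum_type]
  simp only [Finset.univ_unique, Finset.sum_singleton, ← add_assoc]
  rfl

open Classical in
/-- The sum of all strings that belong to a rank index. -/
def closedForm (t : Fin K → Fin K → ℝ) (α β : Fin K → Fin 2) (r : Fin K → Fin K → Prop)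
    (s : Finset (Fin K)) : Chan₁ K → ℝ
  | id => str α β r ∅ ∅ s
  | an j => if j ∈ s then str α β r ∅ {j} s else 0
  | cr i => if i ∈ s then str α β r {i} ∅ s else 0
  | done => ∑ i ∈ s, ∑ j ∈ s, t i j * str α β r {i} {j} s

variable {t : Fin K → Fin K → ℝ} {α β : Fin K → Fin 2} {r : Fin K → Fin K → Prop}
  {s : Finset (Fin K)} {k : Fin K}

/-- The strings on `insert k s` are sorted by what sits at `k`: nothing, a creator, an annihilator,
or both. Each possibility is one arrow of the core. For `done` this is the splitting of `i` and `j`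
into the value `k` and values in `s`. -/
theorem closedForm_step [IsStrictOrder (Fin K) r] (h : Step r s k) (c : Chan₁ K) :
    ∑ m, closedForm t α β r s m * ev (α k) (β k) (coreL t k m c) =
      closedForm t α β r (insert k s) c := by
  classical
  have hk := h.notMem
  rw [sum_eq]
  cases c with
  | id =>
    simp only [coreL, ev_single_site, site_Z, closedForm]
    rw [h.str_pass (by simp) (by simp)]
    simp
  | an j =>
    simp only [coreL, ev_single_site, site_Z, site_ite, closedForm]
    simp only [mul_zero, Finset.sum_const_zero, add_zero, mul_ite, ite_mul, zero_mul, one_mul,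
      Finset.sum_ite_eq', Finset.mem_univ, if_true, Finset.mem_insert]
    rcases eq_or_ne j k with rfl | hj
    · simp only [hk, if_true, true_or, if_false, add_zero]
      rw [h.str_add (C' := ∅) (D' := ∅) (c := .A) (by simp)
        (by intro x hx; simp [h.ne hx]) (by simp [siteComp])]
    · simp only [hj, if_false, false_or, zero_add]
      split_ifs with hjs
      · rw [h.str_pass (by simp) (by simpa using hjs)]
        simp
      · rfl
  | cr j =>
    simp only [coreL, ev_single_site, site_Z, site_ite, closedForm]
    simp only [mul_zero, Finset.sum_const_zero, add_zero, mul_ite, ite_mul, zero_mul, one_mul,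
      Finset.sum_ite_eq', Finset.mem_univ, if_true, Finset.mem_insert]
    rcases eq_or_ne j k with rfl | hj
    · simp only [hk, if_true, true_or, if_false, add_zero]
      rw [h.str_add (C' := ∅) (D' := ∅) (c := .Astar)
        (by intro x hx; simp [h.ne hx]) (by simp) (by simp [siteComp])]
    · simp only [hj, if_false, false_or, zero_add]
      split_ifs with hjs
      · rw [h.str_pass (by simpa using hjs) (by simp)]
        simp
      · rfl
  | done =>
    simp only [coreL, ev_single_site, closedForm, ite_mul, zero_mul, Finset.sum_ite_mem,
      Finset.univ_inter, one_mul, Finset.sum_insert hk]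
    have h1 : str α β r {k} {k} (insert k s) = str α β r ∅ ∅ s * site α β .AstarA k :=
      h.str_add (by intro x hx; simp [h.ne hx]) (by intro x hx; simp [h.ne hx])
        (by simp [siteComp])
    have h2 : ∑ j ∈ s, t k j * str α β r {k} {j} (insert k s) =
        ∑ j ∈ s, t k j * (str α β r ∅ {j} s * site α β .Astar k) :=
      Finset.sum_congr rfl fun j hj => by
        rw [h.str_add (c := .Astar) (C' := ∅) (by intro x hx; simp [h.ne hx]) (fun _ _ => Iff.rfl)
          (by simp [siteComp, (h.ne hj).symm])]
    have h3 : ∀ j ∈ s, str α β r {j} {k} (insert k s) = str α β r {j} ∅ s * site α β .A k :=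
      fun j hj => h.str_add (by simp) (by intro x hx; simp [h.ne hx])
        (by simp [siteComp, (h.ne hj).symm])
    have h4 : ∀ i ∈ s, ∀ j ∈ s, str α β r {i} {j} (insert k s) =
        str α β r {i} {j} s * site α β .I k := fun i hi j hj => by
      rw [h.str_pass (by simpa using hi) (by simpa using hj)]; simp
    have h5 : ∑ i ∈ s, (t i k * str α β r {i} {k} (insert k s) +
          ∑ j ∈ s, t i j * str α β r {i} {j} (insert k s)) =
        ∑ i ∈ s, (t i k * (str α β r {i} ∅ s * site α β .A k) +
          ∑ j ∈ s, t i j * (str α β r {i} {j} s * site α β .I k)) :=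
      Finset.sum_congr rfl fun i hi => by
        rw [h3 i hi, Finset.sum_congr rfl fun j hj => by rw [h4 i hi j hj]]
    rw [h1, h2, h5, Finset.sum_add_distrib]
    simp only [Finset.sum_mul, mul_assoc, mul_left_comm (str _ _ _ _ _ _)]
    ring

end Chan₁

namespace Chan₂

variable {K : ℕ}

lemma sum_eq (g : Chan₂ K → ℝ) :
    ∑ m, g m = g id + ∑ i, g (cr i) + ∑ j, g (an j) + ∑ i, ∑ j, g (ca i j) +
      ∑ i, ∑ j, g (cc i j) + ∑ i, ∑ j, g (aa i j) + ∑ j, g (needAn j) + ∑ i, g (needCr i) +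
      g done := by
  rw [← (Chan₂.proxyTypeEquiv K).sum_comp]
  simp only [Fintype.sum_sum_type, Fintype.sum_sigma]
  simp only [Finset.univ_unique, Finset.sum_singleton, ← add_assoc]
  rfl
end Chan₂

/-! ### Closed forms: two-particle operator -/

/-- The indices `cc` and `aa` test only the later site for membership in `s`. The earlier site
follows because `s` is closed under predecessors, and the order condition is already enforced by
`g`. -/
lemma Step.sum_rel {K : ℕ} {r : Fin K → Fin K → Prop} {s : Finset (Fin K)} {k : Fin K}
    [IsStrictOrder (Fin K) r] [DecidableRel r] (h : Step r s k) (g : Fin K → Fin K → ℝ)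
    (hg : ∀ i j, ¬ r i j → g i j = 0) :
    (∑ i, ∑ j, if r i j ∧ j ∈ s then g i j else 0) = ∑ i ∈ s, ∑ j ∈ s, g i j := by
  classical
  rw [← Finset.sum_subset (Finset.subset_univ s) fun i _ hi => Finset.sum_eq_zero fun j _ =>
    if_neg fun hij => hi (h.lower j hij.2 i hij.1)]
  refine Finset.sum_congr rfl fun i _ => ?_
  rw [← Finset.sum_subset (Finset.subset_univ s) fun j _ hj => if_neg fun hij => hj hij.2]
  refine Finset.sum_congr rfl fun j hj => ?_
  by_cases hr : r i j
  · rw [if_pos ⟨hr, hj⟩]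
  · rw [if_neg fun hij => hr hij.1, hg i j hr]

lemma sum_mem_and {ι : Type*} [Fintype ι] [DecidableEq ι] (s : Finset ι) (g : ι → ι → ℝ) :
    (∑ i, ∑ j, if i ∈ s ∧ j ∈ s then g i j else 0) = ∑ i ∈ s, ∑ j ∈ s, g i j := by
  rw [← Finset.sum_subset (Finset.subset_univ s) fun i _ hi => Finset.sum_eq_zero fun j _ =>
    if_neg fun hij => hi hij.1]
  refine Finset.sum_congr rfl fun i hi => ?_
  rw [← Finset.sum_subset (Finset.subset_univ s) fun j _ hj => if_neg fun hij => hj hij.2]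
  exact Finset.sum_congr rfl fun j hj => if_pos ⟨hi, hj⟩

namespace Chan₂

variable {K : ℕ}

open Classical in
/-- The sum of all strings that belong to a rank index. -/
def closedForm (w : Fin K → Fin K → Fin K → Fin K → ℝ) (α β : Fin K → Fin 2)
    (r : Fin K → Fin K → Prop) (s : Finset (Fin K)) : Chan₂ K → ℝ
  | id => str α β r ∅ ∅ s
  | cr i => if i ∈ s then str α β r {i} ∅ s else 0
  | an j => if j ∈ s then str α β r ∅ {j} s else 0
  | ca i j => if i ∈ s ∧ j ∈ s then str α β r {i} {j} s else 0
  | cc i₁ i₂ => if r i₁ i₂ ∧ i₂ ∈ s then str α β r {i₁, i₂} ∅ s else 0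
  | aa j₁ j₂ => if r j₁ j₂ ∧ j₂ ∈ s then str α β r ∅ {j₁, j₂} s else 0
  -- The value `0` for processed `j` makes the closed form vanish at indices that are not live; in
  -- exchange the recursion holds only for `Pending` indices.
  | needAn j => if j ∈ s then 0 else
      ∑ i₁ ∈ s, ∑ i₂ ∈ s, ∑ j₁ ∈ s, w i₁ i₂ j₁ j * str α β r {i₁, i₂} {j₁} s
  | needCr i => if i ∈ s then 0 else
      ∑ i₁ ∈ s, ∑ j₁ ∈ s, ∑ j₂ ∈ s, w i₁ i j₁ j₂ * str α β r {i₁} {j₁, j₂} s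
  | done => ∑ i₁ ∈ s, ∑ i₂ ∈ s, ∑ j₁ ∈ s, ∑ j₂ ∈ s,
      w i₁ i₂ j₁ j₂ * str α β r {i₁, i₂} {j₁, j₂} s

/-- The indices with closed forms that satisfy the recursion. -/
def Pending (s : Finset (Fin K)) : Chan₂ K → Prop
  | needAn j => j ∉ s
  | needCr i => i ∉ s
  | _ => True

/-- Coefficients that vanish unless the creators and the annihilators are ordered. -/
structure Ordered (r : Fin K → Fin K → Prop) (w : Fin K → Fin K → Fin K → Fin K → ℝ) : Prop where
  left : ∀ i₁ i₂ j₁ j₂, ¬ r i₁ i₂ → w i₁ i₂ j₁ j₂ = 0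
  right : ∀ i₁ i₂ j₁ j₂, ¬ r j₁ j₂ → w i₁ i₂ j₁ j₂ = 0

variable {w : Fin K → Fin K → Fin K → Fin K → ℝ} {α β : Fin K → Fin 2}
  {r : Fin K → Fin K → Prop} {s : Finset (Fin K)} {k : Fin K} [IsStrictOrder (Fin K) r]

lemma closedForm_step_id (h : Step r s k) :
    ∑ m, closedForm w α β r s m * ev (α k) (β k) (coreL w k m id) =
      closedForm w α β r (insert k s) id := by
  simp only [sum_eq, coreL, ev_single_site, site_Z, mul_zero, Finset.sum_const_zero, add_zero,
    one_mul, closedForm]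
  rw [h.str_pass (by simp) (by simp)]
  simp

lemma closedForm_step_cr (h : Step r s k) (i : Fin K) :
    ∑ m, closedForm w α β r s m * ev (α k) (β k) (coreL w k m (cr i)) =
      closedForm w α β r (insert k s) (cr i) := by
  classical
  have hk := h.notMem
  simp only [sum_eq, coreL, ev_single_site, site_Z, site_ite, mul_zero, Finset.sum_const_zero,
    add_zero, one_mul, closedForm, mul_ite, ite_mul, zero_mul, Finset.sum_ite_eq',
    Finset.mem_univ, if_true, Finset.mem_insert]
  rcases eq_or_ne i k with rfl | hi
  · simp only [hk, if_true, true_or, if_false, add_zero]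
    rw [h.str_add (C' := ∅) (D' := ∅) (c := .Astar)
      (by intro x hx; simp [h.ne hx]) (by simp) (by simp [siteComp])]
  · simp only [hi, if_false, false_or, zero_add]
    split_ifs with his
    · rw [h.str_pass (by simpa using his) (by simp)]
      simp
    · rfl

lemma closedForm_step_an (h : Step r s k) (j : Fin K) :
    ∑ m, closedForm w α β r s m * ev (α k) (β k) (coreL w k m (an j)) =
      closedForm w α β r (insert k s) (an j) := by
  classical
  have hk := h.notMem
  simp only [sum_eq, coreL, ev_single_site, site_Z, site_ite, mul_zero, Finset.sum_const_zero,
    add_zero, one_mul, closedForm, mul_ite, ite_mul, zero_mul, Finset.sum_ite_eq',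
    Finset.mem_univ, if_true, Finset.mem_insert]
  rcases eq_or_ne j k with rfl | hj
  · simp only [hk, if_true, true_or, if_false, add_zero]
    rw [h.str_add (C' := ∅) (D' := ∅) (c := .A) (by simp)
      (by intro x hx; simp [h.ne hx]) (by simp [siteComp])]
  · simp only [hj, if_false, false_or, zero_add]
    split_ifs with hjs
    · rw [h.str_pass (by simp) (by simpa using hjs)]
      simp
    · rfl

/-- Both operators at `k` come from `id`, only the creator from `an`, only the annihilator from
`cr`, and neither from `ca`. -/
lemma closedForm_step_ca (h : Step r s k) (i j : Fin K) :
    ∑ m, closedForm w α β r s m * ev (α k) (β k) (coreL w k m (ca i j)) =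
      closedForm w α β r (insert k s) (ca i j) := by
  classical
  have hk := h.notMem
  simp only [sum_eq, coreL, ev_single_site, site_Z, site_ite, mul_zero, Finset.sum_const_zero,
    add_zero, one_mul, closedForm, mul_ite, ite_mul, zero_mul, Finset.sum_ite_eq',
    Finset.mem_univ, if_true, Finset.mem_insert, ite_and, Finset.sum_ite_irrel]
  rcases eq_or_ne k i with rfl | hi <;> rcases eq_or_ne k j with rfl | hj
  · simp only [hk, if_true, true_or, if_false, add_zero]
    rw [h.str_add (C' := ∅) (D' := ∅) (c := .AstarA) (by intro x hx; simp [h.ne hx])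
      (by intro x hx; simp [h.ne hx]) (by simp [siteComp])]
  · simp only [hk, hj.symm, if_true, true_or, false_or, if_false, add_zero, zero_add, ite_self]
    split_ifs with hjs
    · rw [h.str_add (C' := ∅) (D' := {j}) (c := .Astar) (by intro x hx; simp [h.ne hx])
        (by simp) (by simp [siteComp, hj])]
    · rfl
  · simp only [hk, hi.symm, if_true, true_or, false_or, if_false, add_zero, zero_add, ite_self]
    split_ifs with his
    · rw [h.str_add (C' := {i}) (D' := ∅) (c := .A) (by simp) (by intro x hx; simp [h.ne hx])
        (by simp [siteComp, hi])]
    · rfl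
  · simp only [hi.symm, hj.symm, if_false, false_or, zero_add, ite_self]
    split_ifs with his hjs
    · rw [h.str_pass (by simpa using his) (by simpa using hjs)]
      simp
    · rfl
    · rfl

lemma closedForm_step_cc (h : Step r s k) (i₁ i₂ : Fin K) :
    ∑ m, closedForm w α β r s m * ev (α k) (β k) (coreL w k m (cc i₁ i₂)) =
      closedForm w α β r (insert k s) (cc i₁ i₂) := by
  classical
  have hk := h.notMem
  simp only [sum_eq, coreL, ev_single_site, site_Z, site_ite, mul_zero, Finset.sum_const_zero,
    add_zero, one_mul, closedForm, mul_ite, ite_mul, zero_mul, Finset.sum_ite_eq',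
    Finset.mem_univ, if_true, Finset.mem_insert, ite_and, Finset.sum_ite_irrel]
  rcases eq_or_ne i₂ k with rfl | hi
  -- For `i₂ = k` the order condition `r i₁ k` says exactly that `i₁` has been processed, so the
  -- term from `cr i₁` matches.
  · simp only [hk, if_true, true_or, if_false, add_zero, zero_add, ite_self, h.mem_iff i₁]
    split_ifs with hr
    · rw [h.str_add (C' := {i₁}) (D' := ∅) (c := .Astar)
        (by intro x hx; simp [h.ne hx]) (by simp) (by simp [siteComp])]
    · rfl
  · simp only [hi, if_false, false_or, zero_add]
    split_ifs with hr his
    · rw [h.str_pass (by simp [Finset.insert_subset_iff, his, h.lower _ his _ hr]) (by simp),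
        Finset.card_pair (ne_of_irrefl hr)]
      simp
    · rfl
    · rfl

lemma closedForm_step_aa (h : Step r s k) (j₁ j₂ : Fin K) :
    ∑ m, closedForm w α β r s m * ev (α k) (β k) (coreL w k m (aa j₁ j₂)) =
      closedForm w α β r (insert k s) (aa j₁ j₂) := by
  classical
  have hk := h.notMem
  simp only [sum_eq, coreL, ev_single_site, site_Z, site_ite, mul_zero, Finset.sum_const_zero,
    add_zero, one_mul, closedForm, mul_ite, ite_mul, zero_mul, Finset.sum_ite_eq',
    Finset.mem_univ, if_true, Finset.mem_insert, ite_and, Finset.sum_ite_irrel]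
  rcases eq_or_ne j₂ k with rfl | hi
  · simp only [hk, if_true, true_or, if_false, add_zero, zero_add, ite_self, h.mem_iff j₁]
    split_ifs with hr
    · rw [h.str_add (C' := ∅) (D' := {j₁}) (c := .A) (by simp)
        (by intro x hx; simp [h.ne hx]) (by simp [siteComp])]
    · rfl
  · simp only [hi, if_false, false_or, zero_add]
    split_ifs with hr his
    · rw [h.str_pass (by simp) (by simp [Finset.insert_subset_iff, his, h.lower _ his _ hr]),
        Finset.card_pair (ne_of_irrefl hr)]
      simp
    · rfl
    · rfl

/-- Since `w` is ordered, `k` can be the later creator `i₂` but not `i₁`. With `i₂` before `k` the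
contributions are `cc` by `A` and `needAn` by `S` (three operators, odd parity); with `i₂ = k` they
are `cr` by `A*A` and `ca` by `A*`. -/
lemma closedForm_step_needAn (hw : Ordered r w) (h : Step r s k) (j : Fin K)
    (hj : j ∉ insert k s) :
    ∑ m, closedForm w α β r s m * ev (α k) (β k) (coreL w k m (needAn j)) =
      closedForm w α β r (insert k s) (needAn j) := by
  classical
  have hk := h.notMem
  have hjs : j ∉ s := fun h' => hj (Finset.mem_insert_of_mem h')
  simp only [sum_eq, coreL, ev_single_site, site_Z, site_ite, mul_zero, Finset.sum_const_zero,
    add_zero, one_mul, closedForm, mul_ite, ite_mul, zero_mul, Finset.sum_ite_eq',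
    Finset.mem_univ, if_true, if_neg hj, if_neg hjs, sum_mem_and, Finset.sum_ite_mem,
    Finset.univ_inter, zero_add]
  rw [h.sum_rel _ fun i₁ i₂ hr => by rw [hw.left _ _ _ _ hr]; ring,
    h.sum_pairs _ fun i₁ i₂ hr => Finset.sum_eq_zero fun j₁ _ => by
      rw [hw.left _ _ _ _ hr, zero_mul]]
  have e1 : ∀ i₁ ∈ s, ∀ i₂ ∈ s,
      ∑ j₁ ∈ insert k s, w i₁ i₂ j₁ j * str α β r {i₁, i₂} {j₁} (insert k s) =
        w i₁ i₂ k j * (str α β r {i₁, i₂} ∅ s * site α β .A k) +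
          ∑ j₁ ∈ s, w i₁ i₂ j₁ j * (str α β r {i₁, i₂} {j₁} s * site α β .S k) := by
    intro i₁ h1 i₂ h2
    rw [Finset.sum_insert hk]
    congr 1
    · rw [h.str_add (c := .A) (C' := {i₁, i₂}) (D' := ∅) (fun _ _ => Iff.rfl)
        (by intro x hx; simp [h.ne hx]) (by simp [siteComp, (h.ne h1).symm, (h.ne h2).symm])]
    · refine Finset.sum_congr rfl fun j₁ h3 => ?_
      by_cases hr : r i₁ i₂
      · rw [h.str_pass (by simp [Finset.insert_subset_iff, h1, h2]) (by simpa using h3),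
          Finset.card_pair (ne_of_irrefl hr)]
        simp [Nat.even_add_one]
      · simp [hw.left _ _ _ _ hr]
  have e2 : ∀ i₁ ∈ s,
      ∑ j₁ ∈ insert k s, w i₁ k j₁ j * str α β r {i₁, k} {j₁} (insert k s) =
        w i₁ k k j * (str α β r {i₁} ∅ s * site α β .AstarA k) +
          ∑ j₁ ∈ s, w i₁ k j₁ j * (str α β r {i₁} {j₁} s * site α β .Astar k) := by
    intro i₁ h1
    rw [Finset.sum_insert hk]
    congr 1
    · rw [h.str_add (c := .AstarA) (C' := {i₁}) (D' := ∅) (by intro x hx; simp [h.ne hx])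
        (by intro x hx; simp [h.ne hx]) (by simp [siteComp])]
    · refine Finset.sum_congr rfl fun j₁ h3 => ?_
      rw [h.str_add (c := .Astar) (C' := {i₁}) (D' := {j₁}) (by intro x hx; simp [h.ne hx])
        (fun _ _ => Iff.rfl) (by simp [siteComp, (h.ne h3).symm])]
  rw [Finset.sum_congr rfl fun i₁ h1 => Finset.sum_congr rfl (e1 i₁ h1), Finset.sum_congr rfl e2]
  simp only [Finset.sum_add_distrib, Finset.sum_mul, mul_assoc, mul_left_comm (str _ _ _ _ _ _)]
  ring

/-- Here `k` can be the single creator, the later annihilator, or both. The case `i₁ = k` collects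
`aa` and `an`, the case `i₁ ∈ s` collects `needCr` and `ca`. -/
lemma closedForm_step_needCr (hw : Ordered r w) (h : Step r s k) (i : Fin K)
    (hi : i ∉ insert k s) :
    ∑ m, closedForm w α β r s m * ev (α k) (β k) (coreL w k m (needCr i)) =
      closedForm w α β r (insert k s) (needCr i) := by
  classical
  have hk := h.notMem
  have his : i ∉ s := fun h' => hi (Finset.mem_insert_of_mem h')
  simp only [sum_eq, coreL, ev_single_site, site_Z, site_ite, mul_zero, Finset.sum_const_zero,
    add_zero, one_mul, closedForm, mul_ite, ite_mul, zero_mul, Finset.sum_ite_eq',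
    Finset.mem_univ, if_true, if_neg hi, if_neg his, sum_mem_and, Finset.sum_ite_mem,
    Finset.univ_inter, zero_add]
  rw [h.sum_rel _ fun j₁ j₂ hr => by rw [hw.right _ _ _ _ hr]; ring, Finset.sum_insert hk]
  have e1 : ∑ j₁ ∈ insert k s, ∑ j₂ ∈ insert k s,
        w k i j₁ j₂ * str α β r {k} {j₁, j₂} (insert k s) =
      (∑ j₁ ∈ s, ∑ j₂ ∈ s, w k i j₁ j₂ * (str α β r ∅ {j₁, j₂} s * site α β .Astar k)) +
        ∑ j₁ ∈ s, w k i j₁ k * (str α β r ∅ {j₁} s * site α β .AstarA k) := by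
    rw [h.sum_pairs _ fun j₁ j₂ hr => by rw [hw.right _ _ _ _ hr, zero_mul]]
    congr 1
    · refine Finset.sum_congr rfl fun j₁ h1 => Finset.sum_congr rfl fun j₂ h2 => ?_
      rw [h.str_add (c := .Astar) (C' := ∅) (by intro x hx; simp [h.ne hx]) (fun _ _ => Iff.rfl)
        (by simp [siteComp, (h.ne h1).symm, (h.ne h2).symm])]
    · refine Finset.sum_congr rfl fun j₁ h1 => ?_
      rw [h.str_add (c := .AstarA) (C' := ∅) (D' := {j₁}) (by intro x hx; simp [h.ne hx])
        (by intro x hx; simp [h.ne hx]) (by simp [siteComp])]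
  have e2 : ∀ i₁ ∈ s, ∑ j₁ ∈ insert k s, ∑ j₂ ∈ insert k s,
        w i₁ i j₁ j₂ * str α β r {i₁} {j₁, j₂} (insert k s) =
      (∑ j₁ ∈ s, ∑ j₂ ∈ s, w i₁ i j₁ j₂ * (str α β r {i₁} {j₁, j₂} s * site α β .S k)) +
        ∑ j₁ ∈ s, w i₁ i j₁ k * (str α β r {i₁} {j₁} s * site α β .A k) := by
    intro i₁ h3
    rw [h.sum_pairs _ fun j₁ j₂ hr => by rw [hw.right _ _ _ _ hr, zero_mul]]
    congr 1
    · refine Finset.sum_congr rfl fun j₁ h1 => Finset.sum_congr rfl fun j₂ h2 => ?_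
      by_cases hr : r j₁ j₂
      · rw [h.str_pass (by simpa using h3) (by simp [Finset.insert_subset_iff, h1, h2]),
          Finset.card_pair (ne_of_irrefl hr)]
        simp [show ¬ Even 3 by decide]
      · simp [hw.right _ _ _ _ hr]
    · refine Finset.sum_congr rfl fun j₁ h1 => ?_
      rw [h.str_add (c := .A) (C' := {i₁}) (D' := {j₁}) (fun _ _ => Iff.rfl)
        (by intro x hx; simp [h.ne hx]) (by simp [siteComp, (h.ne h3).symm])]
  rw [e1, Finset.sum_congr rfl e2]
  simp only [Finset.sum_add_distrib, Finset.sum_mul, mul_assoc, mul_left_comm (str _ _ _ _ _ _)]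
  ring

/-- Only the later creator and the later annihilator can sit at `k`. With neither the source is
`done`, with the annihilator `needAn k`, with the creator `needCr k`, with both `ca`; the sums at
`needAn k` and `needCr k` are nontrivially defined because `k` is not yet processed. -/
lemma closedForm_step_done (hw : Ordered r w) (h : Step r s k) :
    ∑ m, closedForm w α β r s m * ev (α k) (β k) (coreL w k m done) =
      closedForm w α β r (insert k s) done := by
  classical
  have hk := h.notMem
  simp only [sum_eq, coreL, ev_single_site, site_Z, site_ite, mul_zero, Finset.sum_const_zero,
    add_zero, one_mul, closedForm, mul_ite, ite_mul, zero_mul, Finset.sum_ite_eq',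
    Finset.mem_univ, if_true, if_neg hk, sum_mem_and, zero_add]
  rw [h.sum_pairs _ fun i₁ i₂ hr => Finset.sum_eq_zero fun j₁ _ => Finset.sum_eq_zero fun j₂ _ => by
      rw [hw.left _ _ _ _ hr, zero_mul]]
  have e1 : ∀ i₁ ∈ s, ∀ i₂ ∈ s, ∑ j₁ ∈ insert k s, ∑ j₂ ∈ insert k s,
        w i₁ i₂ j₁ j₂ * str α β r {i₁, i₂} {j₁, j₂} (insert k s) =
      (∑ j₁ ∈ s, ∑ j₂ ∈ s, w i₁ i₂ j₁ j₂ * (str α β r {i₁, i₂} {j₁, j₂} s * site α β .I k)) +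
        ∑ j₁ ∈ s, w i₁ i₂ j₁ k * (str α β r {i₁, i₂} {j₁} s * site α β .A k) := by
    intro i₁ h3 i₂ h4
    rw [h.sum_pairs _ fun j₁ j₂ hr => by rw [hw.right _ _ _ _ hr, zero_mul]]
    congr 1
    · refine Finset.sum_congr rfl fun j₁ h1 => Finset.sum_congr rfl fun j₂ h2 => ?_
      by_cases hr : r j₁ j₂
      · by_cases hr' : r i₁ i₂
        · rw [h.str_pass (by simp [Finset.insert_subset_iff, h3, h4])
            (by simp [Finset.insert_subset_iff, h1, h2]),
            Finset.card_pair (ne_of_irrefl hr), Finset.card_pair (ne_of_irrefl hr')]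
          simp [show Even 4 by decide]
        · simp [hw.left _ _ _ _ hr']
      · simp [hw.right _ _ _ _ hr]
    · refine Finset.sum_congr rfl fun j₁ h1 => ?_
      rw [h.str_add (c := .A) (C' := {i₁, i₂}) (D' := {j₁}) (fun _ _ => Iff.rfl)
        (by intro x hx; simp [h.ne hx])
        (by simp [siteComp, (h.ne h3).symm, (h.ne h4).symm])]
  have e2 : ∀ i₁ ∈ s, ∑ j₁ ∈ insert k s, ∑ j₂ ∈ insert k s,
        w i₁ k j₁ j₂ * str α β r {i₁, k} {j₁, j₂} (insert k s) =
      (∑ j₁ ∈ s, ∑ j₂ ∈ s, w i₁ k j₁ j₂ * (str α β r {i₁} {j₁, j₂} s * site α β .Astar k)) +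
        ∑ j₁ ∈ s, w i₁ k j₁ k * (str α β r {i₁} {j₁} s * site α β .AstarA k) := by
    intro i₁ h3
    rw [h.sum_pairs _ fun j₁ j₂ hr => by rw [hw.right _ _ _ _ hr, zero_mul]]
    congr 1
    · refine Finset.sum_congr rfl fun j₁ h1 => Finset.sum_congr rfl fun j₂ h2 => ?_
      rw [h.str_add (c := .Astar) (C' := {i₁}) (by intro x hx; simp [h.ne hx])
        (fun _ _ => Iff.rfl) (by simp [siteComp, (h.ne h1).symm, (h.ne h2).symm])]
    · refine Finset.sum_congr rfl fun j₁ h1 => ?_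
      rw [h.str_add (c := .AstarA) (C' := {i₁}) (D' := {j₁}) (by intro x hx; simp [h.ne hx])
        (by intro x hx; simp [h.ne hx]) (by simp [siteComp])]
  rw [Finset.sum_congr rfl fun i₁ h1 => Finset.sum_congr rfl (e1 i₁ h1), Finset.sum_congr rfl e2]
  simp only [Finset.sum_add_distrib, Finset.sum_mul, mul_assoc, mul_left_comm (str _ _ _ _ _ _)]
  ring

theorem closedForm_step (hw : Ordered r w) (h : Step r s k) (c : Chan₂ K)
    (hc : Pending (insert k s) c) :
    ∑ m, closedForm w α β r s m * ev (α k) (β k) (coreL w k m c) =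
      closedForm w α β r (insert k s) c := by
  cases c with
  | id => exact closedForm_step_id h
  | cr i => exact closedForm_step_cr h i
  | an j => exact closedForm_step_an h j
  | ca i j => exact closedForm_step_ca h i j
  | cc i₁ i₂ => exact closedForm_step_cc h i₁ i₂
  | aa j₁ j₂ => exact closedForm_step_aa h j₁ j₂
  | needAn j => exact closedForm_step_needAn hw h j hc
  | needCr i => exact closedForm_step_needCr hw h i hc
  | done => exact closedForm_step_done hw h

end Chan₂

/-! ### Gluing the two halves -/

section Halves

variable {K : ℕ}

/-- The sites to the left of bond `b`. -/
def below (b : ℕ) : Finset (Fin K) := Finset.univ.filter fun x => (x : ℕ) < b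

/-- The sites to the right of bond `b`. -/
def above (b : ℕ) : Finset (Fin K) := Finset.univ.filter fun x => b ≤ (x : ℕ)

@[simp] lemma mem_below {b : ℕ} {x : Fin K} : x ∈ below b ↔ (x : ℕ) < b := by simp [below]

@[simp] lemma mem_above {b : ℕ} {x : Fin K} : x ∈ above b ↔ b ≤ (x : ℕ) := by simp [above]

lemma step_below (k : Fin K) : Step (· < ·) (below k) k := ⟨fun x => by simp⟩

lemma step_above (k : Fin K) : Step (· > ·) (above (k + 1)) k :=
  ⟨fun x => by simp⟩

lemma insert_below (k : Fin K) : insert k (below k) = (below (k + 1) : Finset (Fin K)) := by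
  ext x; simp [Fin.ext_iff]; omega

lemma insert_above (k : Fin K) : insert k (above (k + 1)) = (above k : Finset (Fin K)) := by
  ext x; simp [Fin.ext_iff]; omega

lemma below_zero : (below 0 : Finset (Fin K)) = ∅ := by ext x; simp

lemma above_last : (above K : Finset (Fin K)) = ∅ := by ext x; simp

lemma compl_below (b : ℕ) : (below b : Finset (Fin K))ᶜ = above b := by ext x; simp

lemma str_empty (α β : Fin K → Fin 2) (r : Fin K → Fin K → Prop) (C D : Finset (Fin K)) :
    str α β r C D ∅ = 1 := by simp [str]

/-- A string with an even number of operators looks the same from both sides. -/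
lemma siteComp_gt {C D : Finset (Fin K)} (h : Even (C.card + D.card)) (k : Fin K) :
    siteComp (· > ·) C D k = siteComp (· < ·) C D k := by
  classical
  have key : ∀ E : Finset (Fin K), k ∉ E →
      (E.filter fun x => x > k).card + (E.filter fun x => x < k).card = E.card := by
    intro E hE
    rw [← Finset.card_filter_add_card_filter_not (s := E) fun x => x > k]
    congr 2
    refine Finset.filter_congr fun x hx => ?_
    have : x ≠ k := fun e => hE (e ▸ hx)
    omega
  unfold siteComp
  by_cases hC : k ∈ C <;> by_cases hD : k ∈ D <;> simp only [hC, hD, if_true, if_false]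
  have h1 := key C hC
  have h2 := key D hD
  have h3 : Even ((C.filter fun x => x > k).card + (D.filter fun x => x > k).card) ↔
      Even ((C.filter fun x => x < k).card + (D.filter fun x => x < k).card) := by
    rw [← h1, ← h2] at h
    grind
  by_cases he : Even ((C.filter fun x => x < k).card + (D.filter fun x => x < k).card)
  · rw [if_pos (h3.2 he), if_pos he]
  · rw [if_neg (mt h3.1 he), if_neg he]

/-- A string with an even number of operators is composed of its left and its right part. -/
lemma str_join {α β : Fin K → Fin 2} (b : ℕ) {C D C₁ D₁ C₂ D₂ : Finset (Fin K)}
    (h : Even (C.card + D.card))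
    (hC₁ : ∀ x ∈ below b, x ∈ C ↔ x ∈ C₁) (hD₁ : ∀ x ∈ below b, x ∈ D ↔ x ∈ D₁)
    (hC₂ : ∀ x ∈ above b, x ∈ C ↔ x ∈ C₂) (hD₂ : ∀ x ∈ above b, x ∈ D ↔ x ∈ D₂) :
    str α β (· < ·) C D Finset.univ =
      str α β (· < ·) C₁ D₁ (below b) * str α β (· > ·) C₂ D₂ (above b) := by
  rw [← str_congr (fun y hy x hxy => ?_) hC₁ hD₁, ← str_congr (fun y hy x hxy => ?_) hC₂ hD₂]
  · simp only [str, siteComp_gt h]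
    rw [← compl_below, Finset.prod_mul_prod_compl]
  · simp only [mem_above] at *; omega
  · simp only [mem_below] at *; omega

lemma sum_below_add_above (b : ℕ) (f : Fin K → ℝ) :
    ∑ i, f i = ∑ i ∈ below b, f i + ∑ i ∈ above b, f i := by
  rw [← compl_below, Finset.sum_add_sum_compl]

lemma sum_sum_split (b : ℕ) (f : Fin K → Fin K → ℝ) :
    ∑ i, ∑ j, f i j = ∑ i ∈ below b, ∑ j ∈ below b, f i j + ∑ i ∈ below b, ∑ j ∈ above b, f i j +
      ∑ i ∈ above b, ∑ j ∈ below b, f i j + ∑ i ∈ above b, ∑ j ∈ above b, f i j := by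
  rw [sum_below_add_above b]
  simp only [sum_below_add_above b (f _), Finset.sum_add_distrib]
  ring

end Halves

/-! ### The matrix of the one-particle representation -/

namespace Chan₁

variable {K : ℕ}

/-- This transposition turns the recursion from the right into `closedForm_step` for the order `>`.
-/
lemma coreR_eq (t : Fin K → Fin K → ℝ) (k : Fin K) (m m' : Chan₁ K) :
    coreR t k m m' = coreL t k m' m := by
  cases m <;> cases m' <;> simp only [coreR, coreL, eq_comm]

/-- Splitting `i` and `j` by the half they belong to gives four sums, matched with the four kinds of
nonzero entries of the middle matrix; `str_join` factors the string in each. -/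
theorem matrix_eq (t : Fin K → Fin K → ℝ) (h0 : 0 < K / 2) (α β : Fin K → Fin 2) :
    (oneParticleMPO t).matrix α β =
      ∑ i, ∑ j, t i j * str α β (· < ·) {i} {j} Finset.univ := by
  classical
  rw [oneParticleMPO, glue_matrix h0 α β (fun b => closedForm t α β (· < ·) (below b))
    (fun b => closedForm t α β (· > ·) (above b))]
  · have join : ∀ (i j : Fin K) (C₁ D₁ C₂ D₂ : Finset (Fin K)),
        (∀ x ∈ below (K / 2), x ∈ ({i} : Finset (Fin K)) ↔ x ∈ C₁) →
        (∀ x ∈ below (K / 2), x ∈ ({j} : Finset (Fin K)) ↔ x ∈ D₁) →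
        (∀ x ∈ above (K / 2), x ∈ ({i} : Finset (Fin K)) ↔ x ∈ C₂) →
        (∀ x ∈ above (K / 2), x ∈ ({j} : Finset (Fin K)) ↔ x ∈ D₂) →
        str α β (· < ·) {i} {j} Finset.univ =
          str α β (· < ·) C₁ D₁ (below (K / 2)) * str α β (· > ·) C₂ D₂ (above (K / 2)) :=
      fun i j _ _ _ _ h1 h2 h3 h4 => str_join (K / 2) (by simp) h1 h2 h3 h4
    have hB : ∀ i ∈ (below (K / 2) : Finset (Fin K)), ∀ x ∈ (above (K / 2) : Finset (Fin K)),
        x ≠ i := by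
      intro i hi x hx e; simp only [mem_below, mem_above] at *; subst e; omega
    have hA : ∀ i ∈ (above (K / 2) : Finset (Fin K)), ∀ x ∈ (below (K / 2) : Finset (Fin K)),
        x ≠ i := fun i hi x hx e => hB x hx i hi e.symm
    simp only [sum_eq, mid, closedForm, mul_zero, zero_mul, Finset.sum_const_zero, add_zero,
      zero_add, mul_one, ite_mul, mul_ite, Finset.sum_ite_mem, Finset.univ_inter,
      Finset.sum_ite_irrel]
    rw [sum_sum_split (K / 2)]
    have e1 : ∑ i ∈ below (K / 2), ∑ j ∈ below (K / 2),
          t i j * str α β (· < ·) {i} {j} Finset.univ =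
        ∑ i ∈ below (K / 2), ∑ j ∈ below (K / 2), t i j *
          (str α β (· < ·) {i} {j} (below (K / 2)) * str α β (· > ·) ∅ ∅ (above (K / 2))) := by
      refine Finset.sum_congr rfl fun i hi => Finset.sum_congr rfl fun j hj => ?_
      rw [join i j {i} {j} ∅ ∅ (fun _ _ => Iff.rfl) (fun _ _ => Iff.rfl)
        (by intro x hx; simp [hB i hi x hx]) (by intro x hx; simp [hB j hj x hx])]
    have e2 : ∑ i ∈ below (K / 2), ∑ j ∈ above (K / 2),
          t i j * str α β (· < ·) {i} {j} Finset.univ =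
        ∑ i ∈ below (K / 2), ∑ j ∈ above (K / 2), t i j *
          (str α β (· < ·) {i} ∅ (below (K / 2)) * str α β (· > ·) ∅ {j} (above (K / 2))) := by
      refine Finset.sum_congr rfl fun i hi => Finset.sum_congr rfl fun j hj => ?_
      rw [join i j {i} ∅ ∅ {j} (fun _ _ => Iff.rfl) (by intro x hx; simp [hA j hj x hx])
        (by intro x hx; simp [hB i hi x hx]) (fun _ _ => Iff.rfl)]
    have e3 : ∑ i ∈ above (K / 2), ∑ j ∈ below (K / 2),
          t i j * str α β (· < ·) {i} {j} Finset.univ =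
        ∑ i ∈ above (K / 2), ∑ j ∈ below (K / 2), t i j *
          (str α β (· < ·) ∅ {j} (below (K / 2)) * str α β (· > ·) {i} ∅ (above (K / 2))) := by
      refine Finset.sum_congr rfl fun i hi => Finset.sum_congr rfl fun j hj => ?_
      rw [join i j ∅ {j} {i} ∅ (by intro x hx; simp [hA i hi x hx]) (fun _ _ => Iff.rfl)
        (fun _ _ => Iff.rfl) (by intro x hx; simp [hB j hj x hx])]
    have e4 : ∑ i ∈ above (K / 2), ∑ j ∈ above (K / 2),
          t i j * str α β (· < ·) {i} {j} Finset.univ =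
        ∑ i ∈ above (K / 2), ∑ j ∈ above (K / 2), t i j *
          (str α β (· < ·) ∅ ∅ (below (K / 2)) * str α β (· > ·) {i} {j} (above (K / 2))) := by
      refine Finset.sum_congr rfl fun i hi => Finset.sum_congr rfl fun j hj => ?_
      rw [join i j ∅ ∅ {i} {j} (by intro x hx; simp [hA i hi x hx])
        (by intro x hx; simp [hA j hj x hx]) (fun _ _ => Iff.rfl) (fun _ _ => Iff.rfl)]
    rw [e1, e2, e3, e4, Finset.sum_comm (s := above (K / 2)) (t := below (K / 2))]
    simp only [Finset.sum_mul, Finset.mul_sum, mul_assoc, mul_left_comm (str _ _ _ _ _ _) (t _ _)]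
    ring
  · intro c hc
    cases c <;> simp_all [liveL, closedForm, below_zero, str_empty]
  · intro c hc
    cases c with
    | id => simp [closedForm, above_last, str_empty]
    | an j => exact absurd j.2 (not_lt.2 hc)
    | cr j => exact absurd j.2 (not_lt.2 hc)
    | done => exact absurd hc (by simp [liveR])
  · intro b c hc
    cases c with
    | id => exact absurd trivial hc
    | an j => exact if_neg (by simpa [liveL] using hc)
    | cr j => exact if_neg (by simpa [liveL] using hc)
    | done =>
      obtain rfl : b = 0 := by simp only [liveL] at hc; omega
      simp [closedForm, below_zero]
  · intro b c hc
    cases c with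
    | id => exact absurd trivial hc
    | an j => exact if_neg (by simpa [liveR] using hc)
    | cr j => exact if_neg (by simpa [liveR] using hc)
    | done =>
      have : (above b : Finset (Fin K)) = ∅ := by
        ext x; simp only [liveR] at hc; have := x.2; simp; omega
      simp [closedForm, this]
  · intro k c _
    rw [closedForm_step (step_below k), insert_below]
  · intro k c _
    simp only [coreR_eq, mul_comm (ev _ _ _)]
    rw [closedForm_step (step_above k), insert_above]

end Chan₁

/-! ### The matrix of the two-particle representation -/

lemma sum_rotate {ι : Type*} (B C D : Finset ι) (f : ι → ι → ι → ℝ) :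
    ∑ b ∈ B, ∑ c ∈ C, ∑ d ∈ D, f b c d = ∑ c ∈ C, ∑ d ∈ D, ∑ b ∈ B, f b c d := by
  rw [Finset.sum_comm]
  exact Finset.sum_congr rfl fun _ _ => Finset.sum_comm

lemma sum_rotate₂ {ι : Type*} (A B C D : Finset ι) (f : ι → ι → ι → ι → ℝ) :
    ∑ a ∈ A, ∑ b ∈ B, ∑ c ∈ C, ∑ d ∈ D, f a b c d =
      ∑ c ∈ C, ∑ d ∈ D, ∑ a ∈ A, ∑ b ∈ B, f a b c d := by
  rw [Finset.sum_congr rfl fun a _ => sum_rotate B C D (f a), sum_rotate]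

/-- A sum over all quadruples with terms supported on a product set. -/
lemma sum_quadruple_eq {ι : Type*} [Fintype ι] (A B C D : Finset ι)
    (f g : ι → ι → ι → ι → ℝ)
    (hin : ∀ a ∈ A, ∀ b ∈ B, ∀ c ∈ C, ∀ d ∈ D, g a b c d = f a b c d)
    (hout : ∀ a b c d, ¬ (a ∈ A ∧ b ∈ B ∧ c ∈ C ∧ d ∈ D) → g a b c d = 0) :
    ∑ a, ∑ b, ∑ c, ∑ d, g a b c d = ∑ a ∈ A, ∑ b ∈ B, ∑ c ∈ C, ∑ d ∈ D, f a b c d := by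
  rw [← Finset.sum_subset (Finset.subset_univ A) fun a _ ha => Finset.sum_eq_zero fun b _ =>
    Finset.sum_eq_zero fun c _ => Finset.sum_eq_zero fun d _ => hout a b c d fun h => ha h.1]
  refine Finset.sum_congr rfl fun a ha => ?_
  rw [← Finset.sum_subset (Finset.subset_univ B) fun b _ hb =>
    Finset.sum_eq_zero fun c _ => Finset.sum_eq_zero fun d _ => hout a b c d fun h => hb h.2.1]
  refine Finset.sum_congr rfl fun b hb => ?_
  rw [← Finset.sum_subset (Finset.subset_univ C) fun c _ hc =>
    Finset.sum_eq_zero fun d _ => hout a b c d fun h => hc h.2.2.1]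
  refine Finset.sum_congr rfl fun c hc => ?_
  rw [← Finset.sum_subset (Finset.subset_univ D) fun d _ hd => hout a b c d fun h => hd h.2.2.2]
  exact Finset.sum_congr rfl fun d hd => hin a ha b hb c hc d hd

namespace Chan₂

variable {K : ℕ}

/-- The coefficients seen from the right. -/
def flipCoeff (w : Fin K → Fin K → Fin K → Fin K → ℝ) (i₁ i₂ j₁ j₂ : Fin K) : ℝ := w i₂ i₁ j₂ j₁

/-- The rank indices seen from the right. -/
def flip : Chan₂ K → Chan₂ K
  | id => id
  | cr i => cr i
  | an j => an j
  | ca i j => ca i j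
  | cc i₁ i₂ => cc i₂ i₁
  | aa j₁ j₂ => aa j₂ j₁
  | needAn j => needAn j
  | needCr i => needCr i
  | done => done

lemma flip_involutive : Function.Involutive (flip : Chan₂ K → Chan₂ K) := by
  intro c; cases c <;> rfl

lemma sum_flip (g : Chan₂ K → ℝ) : ∑ m, g (flip m) = ∑ m, g m :=
  Equiv.sum_comp (flip_involutive.toPerm flip) g

/-- Read from the right, the larger site of a pair is processed first. Pair indices and coefficients
must therefore be reversed along with the transposition. -/
lemma coreR_eq (w : Fin K → Fin K → Fin K → Fin K → ℝ) (k : Fin K) (m m' : Chan₂ K) :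
    coreR w k m m' = coreL (flipCoeff w) k (flip m') (flip m) := by
  cases m <;> cases m' <;> simp only [coreR, coreL, flip, flipCoeff, eq_comm, and_comm]

lemma Ordered.flipCoeff {w : Fin K → Fin K → Fin K → Fin K → ℝ} (hw : Ordered (· < ·) w) :
    Ordered (· > ·) (flipCoeff w) :=
  ⟨fun _ _ _ _ h => hw.left _ _ _ _ h, fun _ _ _ _ h => hw.right _ _ _ _ h⟩

lemma sum_mid (w : Fin K → Fin K → Fin K → Fin K → ℝ) (l r : Chan₂ K → ℝ) :
    ∑ c, ∑ c', l c * mid w c c' * r c' =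
      l id * r done + ∑ i, l (cr i) * r (needCr i) + ∑ j, l (an j) * r (needAn j) +
      ∑ i₁, ∑ j₁, ∑ i₂, ∑ j₂, l (ca i₁ j₁) * w i₁ i₂ j₁ j₂ * r (ca i₂ j₂) +
      ∑ i₁, ∑ i₂, ∑ j₁, ∑ j₂, l (cc i₁ i₂) * w i₁ i₂ j₁ j₂ * r (aa j₁ j₂) +
      ∑ j₁, ∑ j₂, ∑ i₁, ∑ i₂, l (aa j₁ j₂) * w i₁ i₂ j₁ j₂ * r (cc i₁ i₂) +
      ∑ j, l (needAn j) * r (an j) + ∑ i, l (needCr i) * r (cr i) + l done * r id := by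
  simp only [sum_eq, mid, mul_zero, zero_mul, Finset.sum_const_zero, add_zero, zero_add, mul_one,
    mul_ite, ite_mul, Finset.sum_ite_eq, Finset.mem_univ, if_true]

section Middle

variable {w : Fin K → Fin K → Fin K → Fin K → ℝ} {α β : Fin K → Fin 2} (b : ℕ)

/-- `str_join` needs an even number of operators. The coefficient supplies this: where it does not
vanish, both pairs consist of two distinct sites. -/
lemma coeff_mul_str_join (hw : Ordered (· < ·) w) {i₁ i₂ j₁ j₂ : Fin K}
    {C₁ D₁ C₂ D₂ : Finset (Fin K)}
    (hC₁ : ∀ x ∈ below b, x ∈ ({i₁, i₂} : Finset (Fin K)) ↔ x ∈ C₁)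
    (hD₁ : ∀ x ∈ below b, x ∈ ({j₁, j₂} : Finset (Fin K)) ↔ x ∈ D₁)
    (hC₂ : ∀ x ∈ above b, x ∈ ({i₁, i₂} : Finset (Fin K)) ↔ x ∈ C₂)
    (hD₂ : ∀ x ∈ above b, x ∈ ({j₁, j₂} : Finset (Fin K)) ↔ x ∈ D₂) :
    w i₁ i₂ j₁ j₂ * str α β (· < ·) {i₁, i₂} {j₁, j₂} Finset.univ =
      w i₁ i₂ j₁ j₂ * (str α β (· < ·) C₁ D₁ (below b) * str α β (· > ·) C₂ D₂ (above b)) := by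
  by_cases hi : i₁ < i₂
  · by_cases hj : j₁ < j₂
    · rw [str_join b _ hC₁ hD₁ hC₂ hD₂]
      rw [Finset.card_pair hi.ne, Finset.card_pair hj.ne]
      decide
    · simp [hw.right _ _ _ _ hj]
  · simp [hw.left _ _ _ _ hi]

lemma sum_ordered_split {f : Fin K → Fin K → ℝ} (hf : ∀ i j, ¬ i < j → f i j = 0) :
    ∑ i, ∑ j, f i j = ∑ i ∈ below b, ∑ j ∈ below b, f i j + ∑ i ∈ below b, ∑ j ∈ above b, f i j +
      ∑ i ∈ above b, ∑ j ∈ above b, f i j := by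
  rw [sum_sum_split b, Finset.sum_eq_zero (s := above b) (f := fun i => ∑ j ∈ below b, f i j),
    add_zero]
  intro i hi
  refine Finset.sum_eq_zero fun j hj => hf i j ?_
  simp only [mem_below, mem_above] at hi hj
  omega

/-- This and the next two lemmas undo the flip of the coefficients, so that the right sums carry the
same `w` as the full operator. -/
lemma right_needAn (j : Fin K) (hj : j ∈ (below b : Finset (Fin K))) :
    closedForm (flipCoeff w) α β (· > ·) (above b) (needAn j) =
      ∑ i₁ ∈ above b, ∑ i₂ ∈ above b, ∑ j₂ ∈ above b,
        w i₁ i₂ j j₂ * str α β (· > ·) {i₁, i₂} {j₂} (above b) := by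
  rw [closedForm, if_neg (by simp at *; omega), Finset.sum_comm]
  simp only [flipCoeff, Finset.pair_comm]

lemma right_needCr (i : Fin K) (hi : i ∈ (below b : Finset (Fin K))) :
    closedForm (flipCoeff w) α β (· > ·) (above b) (needCr i) =
      ∑ i₂ ∈ above b, ∑ j₁ ∈ above b, ∑ j₂ ∈ above b,
        w i i₂ j₁ j₂ * str α β (· > ·) {i₂} {j₁, j₂} (above b) := by
  rw [closedForm, if_neg (by simp at *; omega)]
  refine Finset.sum_congr rfl fun i₂ _ => ?_
  rw [Finset.sum_comm]
  simp only [flipCoeff, Finset.pair_comm]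

lemma right_done :
    closedForm (flipCoeff w) α β (· > ·) (above b) done =
      ∑ i₁ ∈ above b, ∑ i₂ ∈ above b, ∑ j₁ ∈ above b, ∑ j₂ ∈ above b,
        w i₁ i₂ j₁ j₂ * str α β (· > ·) {i₁, i₂} {j₁, j₂} (above b) := by
  rw [closedForm, Finset.sum_comm]
  refine Finset.sum_congr rfl fun i₁ _ => Finset.sum_congr rfl fun i₂ _ => ?_
  rw [Finset.sum_comm]
  simp only [flipCoeff, Finset.pair_comm]

/-- Multiplication of the left and the right closed forms with the middle matrix. -/
theorem sum_closedForm_mid (hw : Ordered (· < ·) w) :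
    ∑ c, ∑ c', closedForm w α β (· < ·) (below b) c * mid w c c' *
        closedForm (flipCoeff w) α β (· > ·) (above b) (flip c') =
      ∑ i₁, ∑ i₂, ∑ j₁, ∑ j₂,
        w i₁ i₂ j₁ j₂ * str α β (· < ·) {i₁, i₂} {j₁, j₂} Finset.univ := by
  classical
  have hB : ∀ i ∈ (below b : Finset (Fin K)), ∀ x ∈ (above b : Finset (Fin K)), x ≠ i := by
    intro i hi x hx e; simp only [mem_below, mem_above] at *; subst e; omega
  have hA : ∀ i ∈ (above b : Finset (Fin K)), ∀ x ∈ (below b : Finset (Fin K)), x ≠ i :=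
    fun i hi x hx e => hB x hx i hi e.symm
  have nB : ∀ i ∈ (above b : Finset (Fin K)), i ∉ (below b : Finset (Fin K)) :=
    fun i hi hi' => hA i hi i hi' rfl
  have dB : ∀ x y : Fin K, x < y → y ∈ (below b : Finset (Fin K)) → x ∈ (below b : Finset (Fin K)) := by
    intro x y hxy hy; simp only [mem_below] at *; omega
  have dA : ∀ x y : Fin K, x < y → x ∈ (above b : Finset (Fin K)) → y ∈ (above b : Finset (Fin K)) := by
    intro x y hxy hy; simp only [mem_above] at *; omega
  rw [sum_mid w (closedForm w α β (· < ·) (below b)) fun c =>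
    closedForm (flipCoeff w) α β (· > ·) (above b) (flip c)]
  rw [sum_ordered_split b (f := fun i₁ i₂ => ∑ j₁, ∑ j₂,
    w i₁ i₂ j₁ j₂ * str α β (· < ·) {i₁, i₂} {j₁, j₂} Finset.univ) fun i₁ i₂ h => Finset.sum_eq_zero fun j₁ _ => Finset.sum_eq_zero
    fun j₂ _ => by rw [hw.left _ _ _ _ h, zero_mul]]
  -- An ordered pair lies below, across, or above the middle. The three positions for creators and
  -- for annihilators give nine sums, one for each block of the middle matrix (`e1` to `e9`).
  have splitJ : ∀ i₁ i₂, ∑ j₁, ∑ j₂,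
      w i₁ i₂ j₁ j₂ * str α β (· < ·) {i₁, i₂} {j₁, j₂} Finset.univ = _ := fun i₁ i₂ =>
    sum_ordered_split b fun j₁ j₂ h => by rw [hw.right _ _ _ _ h, zero_mul]
  simp only [splitJ, Finset.sum_add_distrib]
  have e1 : closedForm w α β (· < ·) (below b) id *
        closedForm (flipCoeff w) α β (· > ·) (above b) (flip done) =
      ∑ i₁ ∈ above b, ∑ i₂ ∈ above b, ∑ j₁ ∈ above b, ∑ j₂ ∈ above b,
        w i₁ i₂ j₁ j₂ * str α β (· < ·) {i₁, i₂} {j₁, j₂} Finset.univ := by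
    rw [flip, right_done, closedForm]
    simp only [Finset.mul_sum]
    refine Finset.sum_congr rfl fun i₁ h1 => Finset.sum_congr rfl fun i₂ h2 =>
      Finset.sum_congr rfl fun j₁ h3 => Finset.sum_congr rfl fun j₂ h4 => ?_
    rw [coeff_mul_str_join b hw (C₁ := ∅) (D₁ := ∅) (C₂ := {i₁, i₂}) (D₂ := {j₁, j₂})
      (by intro x hx; simp [hA _ h1 x hx, hA _ h2 x hx])
      (by intro x hx; simp [hA _ h3 x hx, hA _ h4 x hx]) (fun _ _ => Iff.rfl) (fun _ _ => Iff.rfl)]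
    ring
  have e2 : ∑ i, closedForm w α β (· < ·) (below b) (cr i) *
        closedForm (flipCoeff w) α β (· > ·) (above b) (flip (needCr i)) =
      ∑ i₁ ∈ below b, ∑ i₂ ∈ above b, ∑ j₁ ∈ above b, ∑ j₂ ∈ above b,
        w i₁ i₂ j₁ j₂ * str α β (· < ·) {i₁, i₂} {j₁, j₂} Finset.univ := by
    rw [← Finset.sum_subset (Finset.subset_univ (below b)) fun i _ hi => by
      rw [closedForm, if_neg hi, zero_mul]]
    refine Finset.sum_congr rfl fun i₁ h1 => ?_
    rw [flip, right_needCr b i₁ h1, closedForm, if_pos h1]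
    simp only [Finset.mul_sum]
    refine Finset.sum_congr rfl fun i₂ h2 =>
      Finset.sum_congr rfl fun j₁ h3 => Finset.sum_congr rfl fun j₂ h4 => ?_
    rw [coeff_mul_str_join b hw (C₁ := {i₁}) (D₁ := ∅) (C₂ := {i₂}) (D₂ := {j₁, j₂})
      (by intro x hx; simp [hA _ h2 x hx]) (by intro x hx; simp [hA _ h3 x hx, hA _ h4 x hx])
      (by intro x hx; simp [hB _ h1 x hx]) (fun _ _ => Iff.rfl)]
    ring
  have e3 : ∑ j, closedForm w α β (· < ·) (below b) (an j) *
        closedForm (flipCoeff w) α β (· > ·) (above b) (flip (needAn j)) =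
      ∑ i₁ ∈ above b, ∑ i₂ ∈ above b, ∑ j₁ ∈ below b, ∑ j₂ ∈ above b,
        w i₁ i₂ j₁ j₂ * str α β (· < ·) {i₁, i₂} {j₁, j₂} Finset.univ := by
    rw [← Finset.sum_subset (Finset.subset_univ (below b)) fun i _ hi => by
      rw [closedForm, if_neg hi, zero_mul], ← sum_rotate]
    refine Finset.sum_congr rfl fun j₁ h3 => ?_
    rw [flip, right_needAn b j₁ h3, closedForm, if_pos h3]
    simp only [Finset.mul_sum]
    refine Finset.sum_congr rfl fun i₁ h1 =>
      Finset.sum_congr rfl fun i₂ h2 => Finset.sum_congr rfl fun j₂ h4 => ?_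
    rw [coeff_mul_str_join b hw (C₁ := ∅) (D₁ := {j₁}) (C₂ := {i₁, i₂}) (D₂ := {j₂})
      (by intro x hx; simp [hA _ h1 x hx, hA _ h2 x hx]) (by intro x hx; simp [hA _ h4 x hx])
      (fun _ _ => Iff.rfl) (by intro x hx; simp [hB _ h3 x hx])]
    ring
  have e4 : ∑ i₁, ∑ j₁, ∑ i₂, ∑ j₂, closedForm w α β (· < ·) (below b) (ca i₁ j₁) *
        w i₁ i₂ j₁ j₂ * closedForm (flipCoeff w) α β (· > ·) (above b) (flip (ca i₂ j₂)) =
      ∑ i₁ ∈ below b, ∑ i₂ ∈ above b, ∑ j₁ ∈ below b, ∑ j₂ ∈ above b,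
        w i₁ i₂ j₁ j₂ * str α β (· < ·) {i₁, i₂} {j₁, j₂} Finset.univ := by
    rw [Finset.sum_congr rfl fun i₁ _ => Finset.sum_comm]
    refine sum_quadruple_eq _ _ _ _ _ _ (fun i₁ h1 i₂ h2 j₁ h3 j₂ h4 => ?_)
      fun i₁ i₂ j₁ j₂ h => ?_
    · rw [coeff_mul_str_join b hw (C₁ := {i₁}) (D₁ := {j₁}) (C₂ := {i₂}) (D₂ := {j₂})
        (by intro x hx; simp [hA _ h2 x hx]) (by intro x hx; simp [hA _ h4 x hx])
        (by intro x hx; simp [hB _ h1 x hx]) (by intro x hx; simp [hB _ h3 x hx]), flip, closedForm,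
        closedForm, if_pos ⟨h1, h3⟩, if_pos ⟨h2, h4⟩]
      ring
    · rw [flip, closedForm, closedForm, mul_assoc, ite_mul, zero_mul, mul_ite, mul_zero, mul_ite,
        mul_zero]
      split_ifs with h1 h2
      · exact absurd ⟨h1.1, h2.1, h1.2, h2.2⟩ h
      · rfl
      · rfl
  have e5 : ∑ i₁, ∑ i₂, ∑ j₁, ∑ j₂, closedForm w α β (· < ·) (below b) (cc i₁ i₂) *
        w i₁ i₂ j₁ j₂ * closedForm (flipCoeff w) α β (· > ·) (above b) (flip (aa j₁ j₂)) =
      ∑ i₁ ∈ below b, ∑ i₂ ∈ below b, ∑ j₁ ∈ above b, ∑ j₂ ∈ above b,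
        w i₁ i₂ j₁ j₂ * str α β (· < ·) {i₁, i₂} {j₁, j₂} Finset.univ := by
    refine sum_quadruple_eq _ _ _ _ _ _ (fun i₁ h1 i₂ h2 j₁ h3 j₂ h4 => ?_)
      fun i₁ i₂ j₁ j₂ h => ?_
    -- `{j₂, j₁}` is listed in the order in which `flip` presents the pair to the right closed form.
    · rw [coeff_mul_str_join b hw (C₁ := {i₁, i₂}) (D₁ := ∅) (C₂ := ∅) (D₂ := {j₂, j₁})
        (fun _ _ => Iff.rfl) (by intro x hx; simp [hA _ h3 x hx, hA _ h4 x hx])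
        (by intro x hx; simp [hB _ h1 x hx, hB _ h2 x hx]) (by simp [or_comm]), flip, closedForm,
        closedForm]
      by_cases hi : i₁ < i₂
      · by_cases hj : j₁ < j₂
        · rw [if_pos ⟨hi, h2⟩, if_pos ⟨hj, h3⟩]; ring
        · simp [hw.right _ _ _ _ hj]
      · simp [hw.left _ _ _ _ hi]
    · rw [flip, closedForm, closedForm, mul_assoc, ite_mul, zero_mul, mul_ite, mul_zero, mul_ite,
        mul_zero]
      split_ifs with h1 h2
      -- The closed forms place only the member of each pair nearest to the middle; `dB` and `dA`
      -- place the other by the ordering.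
      · exact absurd ⟨dB _ _ h1.1 h1.2, h1.2, h2.2, dA _ _ h2.1 h2.2⟩ h
      · rfl
      · rfl
  have e6 : ∑ j₁, ∑ j₂, ∑ i₁, ∑ i₂, closedForm w α β (· < ·) (below b) (aa j₁ j₂) *
        w i₁ i₂ j₁ j₂ * closedForm (flipCoeff w) α β (· > ·) (above b) (flip (cc i₁ i₂)) =
      ∑ i₁ ∈ above b, ∑ i₂ ∈ above b, ∑ j₁ ∈ below b, ∑ j₂ ∈ below b,
        w i₁ i₂ j₁ j₂ * str α β (· < ·) {i₁, i₂} {j₁, j₂} Finset.univ := by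
    rw [sum_rotate₂]
    refine sum_quadruple_eq _ _ _ _ _ _ (fun i₁ h1 i₂ h2 j₁ h3 j₂ h4 => ?_)
      fun i₁ i₂ j₁ j₂ h => ?_
    · rw [coeff_mul_str_join b hw (C₁ := ∅) (D₁ := {j₁, j₂}) (C₂ := {i₂, i₁}) (D₂ := ∅)
        (by intro x hx; simp [hA _ h1 x hx, hA _ h2 x hx]) (fun _ _ => Iff.rfl)
        (by simp [or_comm]) (by intro x hx; simp [hB _ h3 x hx, hB _ h4 x hx]), flip, closedForm,
        closedForm]
      by_cases hi : i₁ < i₂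
      · by_cases hj : j₁ < j₂
        · rw [if_pos ⟨hj, h4⟩, if_pos ⟨hi, h1⟩]; ring
        · simp [hw.right _ _ _ _ hj]
      · simp [hw.left _ _ _ _ hi]
    · rw [flip, closedForm, closedForm, mul_assoc, ite_mul, zero_mul, mul_ite, mul_zero, mul_ite,
        mul_zero]
      split_ifs with h1 h2
      · exact absurd ⟨h2.2, dA _ _ h2.1 h2.2, dB _ _ h1.1 h1.2, h1.2⟩ h
      · rfl
      · rfl
  have e7 : ∑ j, closedForm w α β (· < ·) (below b) (needAn j) *
        closedForm (flipCoeff w) α β (· > ·) (above b) (flip (an j)) =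
      ∑ i₁ ∈ below b, ∑ i₂ ∈ below b, ∑ j₁ ∈ below b, ∑ j₂ ∈ above b,
        w i₁ i₂ j₁ j₂ * str α β (· < ·) {i₁, i₂} {j₁, j₂} Finset.univ := by
    rw [← Finset.sum_subset (Finset.subset_univ (above b)) fun i _ hi => by
      rw [flip, closedForm, closedForm, if_neg hi, mul_zero]]
    rw [Finset.sum_congr rfl fun i₁ _ => (sum_rotate _ _ _ _).symm, Finset.sum_comm
      (s := below b) (t := above b)]
    refine Finset.sum_congr rfl fun j₂ h4 => ?_
    rw [flip, closedForm, closedForm, if_pos h4, if_neg (nB _ h4)]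
    simp only [Finset.sum_mul]
    refine Finset.sum_congr rfl fun i₁ h1 =>
      Finset.sum_congr rfl fun i₂ h2 => Finset.sum_congr rfl fun j₁ h3 => ?_
    rw [coeff_mul_str_join b hw (C₁ := {i₁, i₂}) (D₁ := {j₁}) (C₂ := ∅) (D₂ := {j₂})
      (fun _ _ => Iff.rfl) (by intro x hx; simp [hA _ h4 x hx])
      (by intro x hx; simp [hB _ h1 x hx, hB _ h2 x hx]) (by intro x hx; simp [hB _ h3 x hx])]
    ring
  have e8 : ∑ i, closedForm w α β (· < ·) (below b) (needCr i) *
        closedForm (flipCoeff w) α β (· > ·) (above b) (flip (cr i)) =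
      ∑ i₁ ∈ below b, ∑ i₂ ∈ above b, ∑ j₁ ∈ below b, ∑ j₂ ∈ below b,
        w i₁ i₂ j₁ j₂ * str α β (· < ·) {i₁, i₂} {j₁, j₂} Finset.univ := by
    rw [← Finset.sum_subset (Finset.subset_univ (above b)) fun i _ hi => by
      rw [flip, closedForm, closedForm, if_neg hi, mul_zero]]
    rw [Finset.sum_comm (s := below b) (t := above b)]
    refine Finset.sum_congr rfl fun i₂ h2 => ?_
    rw [flip, closedForm, closedForm, if_pos h2, if_neg (nB _ h2)]
    simp only [Finset.sum_mul]
    refine Finset.sum_congr rfl fun i₁ h1 =>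
      Finset.sum_congr rfl fun j₁ h3 => Finset.sum_congr rfl fun j₂ h4 => ?_
    rw [coeff_mul_str_join b hw (C₁ := {i₁}) (D₁ := {j₁, j₂}) (C₂ := {i₂}) (D₂ := ∅)
      (by intro x hx; simp [hA _ h2 x hx]) (fun _ _ => Iff.rfl)
      (by intro x hx; simp [hB _ h1 x hx]) (by intro x hx; simp [hB _ h3 x hx, hB _ h4 x hx])]
    ring
  have e9 : closedForm w α β (· < ·) (below b) done *
        closedForm (flipCoeff w) α β (· > ·) (above b) (flip id) =
      ∑ i₁ ∈ below b, ∑ i₂ ∈ below b, ∑ j₁ ∈ below b, ∑ j₂ ∈ below b,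
        w i₁ i₂ j₁ j₂ * str α β (· < ·) {i₁, i₂} {j₁, j₂} Finset.univ := by
    simp only [flip, closedForm, Finset.sum_mul]
    refine Finset.sum_congr rfl fun i₁ h1 => Finset.sum_congr rfl fun i₂ h2 =>
      Finset.sum_congr rfl fun j₁ h3 => Finset.sum_congr rfl fun j₂ h4 => ?_
    rw [coeff_mul_str_join b hw (C₁ := {i₁, i₂}) (D₁ := {j₁, j₂}) (C₂ := ∅) (D₂ := ∅)
      (fun _ _ => Iff.rfl) (fun _ _ => Iff.rfl)
      (by intro x hx; simp [hB _ h1 x hx, hB _ h2 x hx])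
      (by intro x hx; simp [hB _ h3 x hx, hB _ h4 x hx])]
    ring
  rw [e1, e2, e3, e4, e5, e6, e7, e8, e9]
  ring

end Middle

theorem matrix_eq (v : Fin K → Fin K → Fin K → Fin K → ℝ) (h0 : 0 < K / 2) (α β : Fin K → Fin 2) :
    (twoParticleMPO v).matrix α β =
      ∑ i₁, ∑ i₂, ∑ j₁, ∑ j₂, -antisymCoeff v i₁ i₂ j₁ j₂ *
        str α β (· < ·) {i₁, i₂} {j₁, j₂} Finset.univ := by
  classical
  set w : Fin K → Fin K → Fin K → Fin K → ℝ := fun i₁ i₂ j₁ j₂ => -antisymCoeff v i₁ i₂ j₁ j₂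
    with hwdef
  have hw : Ordered (· < ·) w :=
    ⟨fun i₁ i₂ j₁ j₂ h => by simp [hwdef, antisymCoeff, h],
      fun i₁ i₂ j₁ j₂ h => by simp [hwdef, antisymCoeff, h]⟩
  rw [twoParticleMPO, glue_matrix h0 α β (fun b => closedForm w α β (· < ·) (below b))
    (fun b c => closedForm (flipCoeff w) α β (· > ·) (above b) (flip c))]
  · exact sum_closedForm_mid (K / 2) hw
  · intro c hc
    cases c <;> simp_all [liveL, closedForm, below_zero, str_empty]
  · intro c hc
    cases c with
    | id => simp [flip, closedForm, above_last, str_empty]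
    | cr i => exact absurd i.2 (not_lt.2 hc)
    | an j => exact absurd j.2 (not_lt.2 hc)
    | ca i j => exact absurd i.2 (not_lt.2 hc.1)
    | cc i j => exact absurd i.2 (not_lt.2 hc.2)
    | aa i j => exact absurd i.2 (not_lt.2 hc.2)
    | needAn j => have : K + 2 ≤ K := hc.1; omega
    | needCr j => have : K + 2 ≤ K := hc.1; omega
    | done => have : K + 2 ≤ K := hc; omega
  · intro b c hc
    -- With fewer than two sites there is no ordered pair, so the sums at `needAn`, `needCr`, `done`
    -- vanish; this is where the liveness bound `2 ≤ b` comes from.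
    have hsmall : b < 2 → ∀ i₁ ∈ (below b : Finset (Fin K)), ∀ i₂ ∈ (below b : Finset (Fin K)),
        ¬ i₁ < i₂ := by
      intro hb i₁ h1 i₂ h2; simp only [mem_below] at *; omega
    cases c with
    | id => exact absurd trivial hc
    | cr i => exact if_neg (by simpa [liveL] using hc)
    | an j => exact if_neg (by simpa [liveL] using hc)
    | ca i j => exact if_neg (by simpa [liveL] using hc)
    | cc i j => exact if_neg (by simpa [liveL] using hc)
    | aa i j => exact if_neg (by simpa [liveL] using hc)
    | needAn j =>
      simp only [closedForm, liveL, mem_below] at hc ⊢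
      split_ifs with hj
      · rfl
      · refine Finset.sum_eq_zero fun i₁ h1 => Finset.sum_eq_zero fun i₂ h2 =>
          Finset.sum_eq_zero fun j₁ h3 => ?_
        rw [hw.left _ _ _ _ (hsmall (by omega) i₁ h1 i₂ h2), zero_mul]
    | needCr j =>
      simp only [closedForm, liveL, mem_below] at hc ⊢
      split_ifs with hj
      · rfl
      · refine Finset.sum_eq_zero fun i₁ h1 => Finset.sum_eq_zero fun j₁ h2 =>
          Finset.sum_eq_zero fun j₂ h3 => ?_
        rw [hw.right _ _ _ _ (hsmall (by omega) j₁ h2 j₂ h3), zero_mul]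
    | done =>
      simp only [closedForm, liveL] at hc ⊢
      refine Finset.sum_eq_zero fun i₁ h1 => Finset.sum_eq_zero fun i₂ h2 =>
        Finset.sum_eq_zero fun j₁ h3 => Finset.sum_eq_zero fun j₂ h4 => ?_
      rw [hw.left _ _ _ _ (hsmall (by omega) i₁ h1 i₂ h2), zero_mul]
  · intro b c hc
    have hsmall : K < b + 2 → ∀ i₁ ∈ (above b : Finset (Fin K)),
        ∀ i₂ ∈ (above b : Finset (Fin K)), ¬ i₁ > i₂ := by
      intro hb i₁ h1 i₂ h2; simp only [mem_above] at *; omega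
    cases c with
    | id => exact absurd trivial hc
    | cr i => exact if_neg (by simpa [liveR] using hc)
    | an j => exact if_neg (by simpa [liveR] using hc)
    | ca i j => exact if_neg (by simpa [liveR] using hc)
    | cc i j => exact if_neg (by simpa [liveR] using hc)
    | aa i j => exact if_neg (by simpa [liveR] using hc)
    | needAn j =>
      simp only [flip, closedForm, liveR, mem_above] at hc ⊢
      split_ifs with hj
      · rfl
      · refine Finset.sum_eq_zero fun i₁ h1 => Finset.sum_eq_zero fun i₂ h2 =>
          Finset.sum_eq_zero fun j₁ h3 => ?_
        rw [hw.flipCoeff.left _ _ _ _ (hsmall (by omega) i₁ h1 i₂ h2), zero_mul]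
    | needCr j =>
      simp only [flip, closedForm, liveR, mem_above] at hc ⊢
      split_ifs with hj
      · rfl
      · refine Finset.sum_eq_zero fun i₁ h1 => Finset.sum_eq_zero fun j₁ h2 =>
          Finset.sum_eq_zero fun j₂ h3 => ?_
        rw [hw.flipCoeff.right _ _ _ _ (hsmall (by omega) j₁ h2 j₂ h3), zero_mul]
    | done =>
      simp only [flip, closedForm, liveR] at hc ⊢
      refine Finset.sum_eq_zero fun i₁ h1 => Finset.sum_eq_zero fun i₂ h2 =>
        Finset.sum_eq_zero fun j₁ h3 => Finset.sum_eq_zero fun j₂ h4 => ?_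
      rw [hw.flipCoeff.left _ _ _ _ (hsmall (by omega) i₁ h1 i₂ h2), zero_mul]
  · intro k c hc
    rw [closedForm_step hw (step_below k), insert_below]
    rw [insert_below]
    cases c <;> simp_all [liveL, Pending]
  · intro k c hc
    simp only [coreR_eq, mul_comm (ev _ _ _)]
    rw [sum_flip fun m => closedForm (flipCoeff w) α β (· > ·) (above (k + 1)) m *
      ev (α k) (β k) (coreL (flipCoeff w) k m (flip c)),
      closedForm_step hw.flipCoeff (step_above k), insert_above]
    rw [insert_above]
    cases c <;> simp_all [liveR, Pending, flip]

end Chan₂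

/-! ### Products of creators and annihilators -/

section Operators

variable {K : ℕ}

/-- The Kronecker product of a family of `2 × 2` matrices. -/
def kron (m : Fin K → Matrix (Fin 2) (Fin 2) ℝ) : Matrix (Fin K → Fin 2) (Fin K → Fin 2) ℝ :=
  fun α β => ∏ k, m k (α k) (β k)

lemma kron_mul (m n : Fin K → Matrix (Fin 2) (Fin 2) ℝ) :
    kron m * kron n = kron fun k => m k * n k := by
  ext α β
  simp only [kron, Matrix.mul_apply, Fintype.prod_sum, Finset.prod_mul_distrib]

lemma kron_transpose (m : Fin K → Matrix (Fin 2) (Fin 2) ℝ) :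
    (kron m).transpose = kron fun k => (m k).transpose := rfl

lemma kron_eq_neg {m n : Fin K → Matrix (Fin 2) (Fin 2) ℝ} (i : Fin K)
    (h : ∀ k, k ≠ i → m k = n k) (hi : m i = -n i) : kron m = -kron n := by
  classical
  ext α β
  simp only [kron, Matrix.neg_apply]
  rw [← Finset.mul_prod_erase _ _ (Finset.mem_univ i), ← Finset.mul_prod_erase _ (fun k =>
    n k (α k) (β k)) (Finset.mem_univ i), hi, Finset.prod_congr rfl fun k hk => by
      rw [h k (Finset.ne_of_mem_erase hk)], Matrix.neg_apply, neg_mul]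

/-- The component at site `k` of a product of annihilators at `D`. -/
def annComp (D : Finset (Fin K)) (k : Fin K) : Comp :=
  if k ∈ D then .A else if Even (D.filter fun x => x > k).card then .I else .S

/-- The component at site `k` of a product of creators at `C`. -/
def crComp (C : Finset (Fin K)) (k : Fin K) : Comp :=
  if k ∈ C then .Astar else if Even (C.filter fun x => x > k).card then .I else .S

lemma annihilation_eq (i : Fin K) : annihilation i = kron fun k => (annComp {i} k).toMatrix := by
  ext α β
  refine Finset.prod_congr rfl fun k _ => ?_
  simp only [annComp, Finset.mem_singleton, Finset.filter_singleton]
  rcases lt_trichotomy k i with h | h | h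
  · simp [h, h.ne]
  · simp [h]
  · simp [h.not_gt, h.ne']

lemma transpose_annComp (C : Finset (Fin K)) (k : Fin K) :
    (annComp C k).toMatrix.transpose = (crComp C k).toMatrix := by
  unfold annComp crComp
  split_ifs <;> ext x y <;> fin_cases x <;> fin_cases y <;>
    simp [Comp.toMatrix, Matrix.transpose_apply]

lemma creation_eq (i : Fin K) : creation i = kron fun k => (crComp {i} k).toMatrix := by
  simp only [creation, annihilation_eq, kron_transpose, transpose_annComp]

lemma filter_pair_card {i j : Fin K} (h : i < j) (k : Fin K) :
    (({i, j} : Finset (Fin K)).filter fun x => x > k).card =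
      if k < i then 2 else if k < j then 1 else 0 := by
  split_ifs with h1 h2
  · rw [Finset.filter_true_of_mem (by intro x hx; simp at hx; rcases hx with rfl | rfl <;> omega),
      Finset.card_pair h.ne]
  · rw [show ({i, j} : Finset (Fin K)).filter (fun x => x > k) = {j} by
      ext x; simp; constructor
      · rintro ⟨rfl | rfl, h3⟩
        · exact absurd h3 h1
        · rfl
      · rintro rfl; exact ⟨Or.inr rfl, h2⟩]
    simp
  · rw [Finset.filter_false_of_mem (by intro x hx; simp at hx; rcases hx with rfl | rfl <;> omega)]
    simp

/-- In this order no sign appears: at site `i` the factor `S` of `a_j` stands before `A`, and `S A =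
A`, whereas the opposite order would give `A S = -A`. -/
lemma annihilation_mul {i j : Fin K} (h : i < j) :
    annihilation j * annihilation i = kron fun k => (annComp {i, j} k).toMatrix := by
  rw [annihilation_eq, annihilation_eq, kron_mul]
  congr 1
  funext k
  simp only [annComp, filter_pair_card h, Finset.mem_singleton, Finset.mem_insert,
    Finset.filter_singleton]
  have cases5 : k < i ∧ k < j ∨ k = i ∧ k < j ∨ i < k ∧ k < j ∨ k = j ∧ i < k ∨ j < k ∧ i < k := by
    omega
  rcases cases5 with h' | h' | h' | h' | h' <;> obtain ⟨h1, h2⟩ := h'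
  · simp [h1, h2, h1.ne, h2.ne]; simp [Comp.toMatrix, Matrix.one_fin_two]
  · simp [h1, h, h.ne]; simp [Comp.toMatrix]
  · simp [h1.not_gt, h1.ne', h2, h2.ne]; simp [Comp.toMatrix]
  · simp [h1, h.not_gt, h.ne']; simp [Comp.toMatrix]
  · simp [h1.not_gt, h1.ne', h2.not_gt, h2.ne']; simp [Comp.toMatrix]

lemma creation_mul {i j : Fin K} (h : i < j) :
    creation i * creation j = kron fun k => (crComp {i, j} k).toMatrix := by
  simp only [creation, ← Matrix.transpose_mul, annihilation_mul h, kron_transpose,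
    transpose_annComp]

lemma annihilation_mul_self (i : Fin K) : annihilation i * annihilation i = 0 := by
  rw [annihilation_eq, kron_mul]
  ext α β
  refine Finset.prod_eq_zero (Finset.mem_univ i) ?_
  generalize α i = x
  generalize β i = y
  fin_cases x <;> fin_cases y <;> simp [annComp, Comp.toMatrix]

/-- For `i < j` the factors at all sites other than `i` commute; the sign comes from site `i` alone,
where `A S = -A` and `S A = A`. -/
lemma annihilation_anticomm (i j : Fin K) :
    annihilation i * annihilation j = -(annihilation j * annihilation i) := by
  have key : ∀ i j : Fin K, i < j →
      annihilation i * annihilation j = -(annihilation j * annihilation i) := by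
    intro i j h
    simp only [annihilation_eq, kron_mul]
    refine kron_eq_neg i (fun k hk => ?_) ?_
    · rcases lt_or_gt_of_ne hk with h1 | h1
      · simp [annComp, hk, h1, (h1.trans h).ne, h1.trans h, Finset.filter_singleton]
      · have h2 : annComp {i} k = .I := by
          simp [annComp, hk, h1.not_gt, Finset.filter_singleton]
        simp [h2, Comp.toMatrix]
    · simp [annComp, h, h.ne, Finset.filter_singleton]
      ext x y; fin_cases x <;> fin_cases y <;> simp [Comp.toMatrix]
  rcases lt_trichotomy i j with h | rfl | h
  · exact key i j h
  · simp [annihilation_mul_self]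
  · rw [key j i h, neg_neg]

lemma creation_anticomm (i j : Fin K) :
    creation i * creation j = -(creation j * creation i) := by
  simp only [creation, ← Matrix.transpose_mul, ← Matrix.transpose_neg]
  rw [annihilation_anticomm]

/-- With creators on the left no sign arises, since `A* S = A*` and `S A = A`. On a site without
operators the powers of `S` multiply, so the parities of the operators to the right add. -/
lemma crComp_mul_annComp (C D : Finset (Fin K)) (k : Fin K) :
    (crComp C k).toMatrix * (annComp D k).toMatrix = (siteComp (· > ·) C D k).toMatrix := by
  classical
  have h : siteComp (· > ·) C D k = if k ∈ C then (if k ∈ D then .AstarA else .Astar)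
      else if k ∈ D then .A
      else if (Even (C.filter fun x => x > k).card ↔ Even (D.filter fun x => x > k).card) then .I
      else .S := by
    unfold siteComp
    simp only [Nat.even_add]
  rw [h]
  unfold crComp annComp
  by_cases hC : k ∈ C <;> by_cases hD : k ∈ D <;>
    by_cases eC : Even (C.filter fun x => x > k).card <;>
    by_cases eD : Even (D.filter fun x => x > k).card <;>
    simp only [hC, hD, eC, eD, if_true, if_false] <;>
    ext x y <;> fin_cases x <;> fin_cases y <;> simp [Comp.toMatrix, Matrix.one_fin_two]

lemma kron_mul_kron_apply {C D : Finset (Fin K)} (h : Even (C.card + D.card))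
    (α β : Fin K → Fin 2) :
    ((kron fun k => (crComp C k).toMatrix) * kron fun k => (annComp D k).toMatrix) α β =
      str α β (· < ·) C D Finset.univ := by
  simp only [kron_mul, crComp_mul_annComp, kron, str, site, siteComp_gt h]

theorem oneParticleOp_apply (t : Fin K → Fin K → ℝ) (α β : Fin K → Fin 2) :
    oneParticleOp t α β = ∑ i, ∑ j, t i j * str α β (· < ·) {i} {j} Finset.univ := by
  simp only [oneParticleOp, Matrix.sum_apply, Matrix.smul_apply, smul_eq_mul]
  refine Finset.sum_congr rfl fun i _ => Finset.sum_congr rfl fun j _ => ?_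
  rw [creation_eq, annihilation_eq, kron_mul_kron_apply (by simp)]

lemma sum_eq_sum_ordered (f : Fin K → Fin K → ℝ) (hf : ∀ i, f i i = 0) :
    ∑ i, ∑ j, f i j = ∑ i, ∑ j, if i < j then f i j + f j i else 0 := by
  have h1 : ∀ i j, f i j = (if i < j then f i j else 0) + if j < i then f i j else 0 := by
    intro i j
    rcases lt_trichotomy i j with h | rfl | h
    · simp [h, h.not_gt]
    · simp [hf]
    · simp [h, h.not_gt]
  have h2 : ∑ i, ∑ j, f i j = (∑ i, ∑ j, if i < j then f i j else 0) +
      ∑ i, ∑ j, if j < i then f i j else 0 := by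
    simp only [← Finset.sum_add_distrib, ← h1]
  rw [h2, Finset.sum_comm (f := fun i j => if j < i then f i j else 0)]
  simp only [← Finset.sum_add_distrib]
  refine Finset.sum_congr rfl fun i _ => Finset.sum_congr rfl fun j _ => ?_
  split_ifs <;> simp

/-- The operator products are antisymmetric in the creators and in the annihilators, so equal
indices drop out and the four arrangements of each ordered quadruple combine into the
antisymmetrized coefficient. -/
theorem twoParticleOp_apply (v : Fin K → Fin K → Fin K → Fin K → ℝ) (α β : Fin K → Fin 2) :
    twoParticleOp v α β = ∑ i₁, ∑ i₂, ∑ j₁, ∑ j₂, -antisymCoeff v i₁ i₂ j₁ j₂ *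
      str α β (· < ·) {i₁, i₂} {j₁, j₂} Finset.univ := by
  classical
  simp only [twoParticleOp, Matrix.sum_apply, Matrix.smul_apply, smul_eq_mul]
  set G : Fin K → Fin K → Fin K → Fin K → ℝ := fun i₁ i₂ j₁ j₂ =>
    (creation i₁ * creation i₂ * annihilation j₁ * annihilation j₂) α β with hG
  have Gi : ∀ i₁ i₂ j₁ j₂, G i₂ i₁ j₁ j₂ = -G i₁ i₂ j₁ j₂ := by
    intro i₁ i₂ j₁ j₂
    simp only [hG]
    rw [creation_anticomm i₂ i₁]
    simp
  have Gj : ∀ i₁ i₂ j₁ j₂, G i₁ i₂ j₂ j₁ = -G i₁ i₂ j₁ j₂ := by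
    intro i₁ i₂ j₁ j₂
    simp only [hG]
    rw [Matrix.mul_assoc _ (annihilation j₂), annihilation_anticomm j₂ j₁, Matrix.mul_neg,
      ← Matrix.mul_assoc]
    rfl
  -- A number equal to its own negative is zero.
  have Gii : ∀ i j₁ j₂, G i i j₁ j₂ = 0 := fun i j₁ j₂ => by have := Gi i i j₁ j₂; linarith
  have Gjj : ∀ i₁ i₂ j, G i₁ i₂ j j = 0 := fun i₁ i₂ j => by have := Gj i₁ i₂ j j; linarith
  have Gstr : ∀ i₁ i₂ j₁ j₂, i₁ < i₂ → j₁ < j₂ →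
      G i₁ i₂ j₁ j₂ = -str α β (· < ·) {i₁, i₂} {j₁, j₂} Finset.univ := by
    intro i₁ i₂ j₁ j₂ hi hj
    -- Exchanging the annihilators brings them to the sign-free order with the larger site first;
    -- this is the origin of the minus sign in `w`.
    rw [Gj i₁ i₂ j₂ j₁]
    simp only [hG]
    rw [Matrix.mul_assoc _ (annihilation j₂), creation_mul hi, annihilation_mul hj,
      kron_mul_kron_apply]
    rw [Finset.card_pair hi.ne, Finset.card_pair hj.ne]
    decide
  change ∑ i₁, ∑ i₂, ∑ j₁, ∑ j₂, v i₁ i₂ j₁ j₂ * G i₁ i₂ j₁ j₂ = _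
  rw [sum_eq_sum_ordered _ fun i => by simp [Gii]]
  refine Finset.sum_congr rfl fun i₁ _ => Finset.sum_congr rfl fun i₂ _ => ?_
  split_ifs with hi
  · simp only [← Finset.sum_add_distrib]
    rw [sum_eq_sum_ordered _ fun j => by simp [Gjj]]
    refine Finset.sum_congr rfl fun j₁ _ => Finset.sum_congr rfl fun j₂ _ => ?_
    split_ifs with hj
    · rw [antisymCoeff, if_pos ⟨hi, hj⟩, Gi i₁ i₂ j₁ j₂, Gi i₁ i₂ j₂ j₁, Gj i₁ i₂ j₁ j₂,
        Gstr _ _ _ _ hi hj]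
      ring
    · simp [antisymCoeff, hj]
  · simp [antisymCoeff, hi]

end Operators

/-! ### Consistency of the shifts -/

/-- All components in `f` change the particle number by `d`. -/
def ChangesBy (d : ℤ) (f : Comp →₀ ℝ) : Prop :=
  ∀ c, f c ≠ 0 → ∀ x y : Fin 2, c.toMatrix x y ≠ 0 → ((x : ℕ) : ℤ) - (y : ℕ) = d

/-- The number of particles that a component adds. -/
def Comp.charge : Comp → ℤ
  | .A => -1
  | .Astar => 1
  | _ => 0

lemma Comp.charge_eq (c : Comp) (x y : Fin 2) (h : c.toMatrix x y ≠ 0) :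
    ((x : ℕ) : ℤ) - (y : ℕ) = c.charge := by
  cases c <;> fin_cases x <;> fin_cases y <;> simp_all [Comp.toMatrix, Comp.charge]

lemma changesBy_single {d : ℤ} (c : Comp) (a : ℝ) (h : c = .Z ∨ c.charge = d) :
    ChangesBy d (Finsupp.single c a) := by
  classical
  intro c' hc' x y hxy
  have : c = c' := by
    by_contra hne
    exact hc' (Finsupp.single_eq_of_ne (Ne.symm hne))
  subst this
  rcases h with rfl | h
  · simp [Comp.toMatrix] at hxy
  · rw [← h]; exact Comp.charge_eq c x y hxy

lemma changesBy_delta {d : ℤ} (p : Prop) [Decidable p] (c : Comp) (h : c.charge = d) :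
    ChangesBy d (delta p c) := by
  refine changesBy_single _ _ ?_
  split_ifs
  · exact Or.inr h
  · exact Or.inl rfl

/-- In the right half the charge `q` counts what the string right of the bond adds. The total is
zero, so the shift is `-q` there, and `hM` says that the middle matrix couples only opposite
charges. -/
theorem shiftConsistent_glue {Γ : Type} [Fintype Γ] {K : ℕ} {liveL liveR : ℕ → Γ → Prop}
    {L R : Fin K → Γ → Γ → Comp →₀ ℝ} {M : Γ → Γ → ℝ} (q : Γ → ℤ)
    (hL : ∀ k m m', ChangesBy (q m' - q m) (L k m m'))
    (hR : ∀ k m m', ChangesBy (q m - q m') (R k m m'))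
    (hM : ∀ m m', M m m' ≠ 0 → q m' = -q m) :
    (glue K liveL liveR L R M).ShiftConsistent
      fun b c => if (b : ℕ) < K / 2 then q c.1 else -q c.1 := by
  classical
  intro k m m' c hc x y hxy
  change (if (k : ℕ) + 1 < K / 2 then q m'.1 else -q m'.1) + ((y : ℕ) : ℤ) =
    (if (k : ℕ) < K / 2 then q m.1 else -q m.1) + ((x : ℕ) : ℤ)
  by_cases h1 : (k : ℕ) + 1 < K / 2
  · have h2 : (glue K liveL liveR L R M).core k m m' = L k m.1 m'.1 := if_pos h1
    rw [h2] at hc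
    have := hL k m.1 m'.1 c hc x y hxy
    rw [if_pos h1, if_pos (by omega)]
    omega
  · by_cases h3 : (k : ℕ) + 1 = K / 2
    · have h2 : (glue K liveL liveR L R M).core k m m' =
          ∑ e : Γ with liveL (k + 1) e, M e m'.1 • L k m.1 e := (if_neg h1).trans (if_pos h3)
      rw [h2, Finsupp.finsetSum_apply] at hc
      obtain ⟨e, -, he⟩ := Finset.exists_ne_zero_of_sum_ne_zero hc
      have he' : M e m'.1 * L k m.1 e c ≠ 0 := he
      have h4 := hM e m'.1 (left_ne_zero_of_mul he')
      have := hL k m.1 e c (right_ne_zero_of_mul he') x y hxy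
      rw [if_neg h1, if_pos (by omega)]
      omega
    · have h2 : (glue K liveL liveR L R M).core k m m' = R k m.1 m'.1 :=
        (if_neg h1).trans (if_neg h3)
      rw [h2] at hc
      have := hR k m.1 m'.1 c hc x y hxy
      rw [if_neg h1, if_neg (by omega)]
      omega

lemma card_glue_bond {Γ : Type} [Fintype Γ] {K : ℕ} {liveL liveR : ℕ → Γ → Prop}
    {L R : Fin K → Γ → Γ → Comp →₀ ℝ} {M : Γ → Γ → ℝ} (b : Fin (K + 1)) (c₀ : Γ)
    (h : ∀ c, (if (b : ℕ) < K / 2 then liveL b c else liveR b c) ↔ c = c₀) :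
    Fintype.card ((glue K liveL liveR L R M).Bond b) = 1 :=
  Fintype.card_eq_one_iff.2 ⟨⟨c₀, (h c₀).2 rfl⟩, fun c => Subtype.ext ((h c.1).1 c.2)⟩

/-- The product of a glued operator representation with a block-sparse state. -/
theorem glue_apply {Γ : Type} [Fintype Γ] {K N : ℕ} {liveL liveR : ℕ → Γ → Prop}
    {L R : Fin K → Γ → Γ → Comp →₀ ℝ} {M : Γ → Γ → ℝ} (q : Γ → ℤ)
    (hL : ∀ k m m', ChangesBy (q m' - q m) (L k m m'))
    (hR : ∀ k m m', ChangesBy (q m - q m') (R k m m'))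
    (hM : ∀ m m', M m m' ≠ 0 → q m' = -q m) (c₀ : Γ) (hq : q c₀ = 0)
    (h0 : ∀ c, liveL 0 c ↔ c = c₀) (hK : ∀ c, liveR K c ↔ c = c₀) (hK0 : 0 < K / 2) (hN : N ≤ K)
    {X : MPS K} (hX : X.IsBlockSparse N) :
    (((glue K liveL liveR L R M).toBlock
        fun b c => if (b : ℕ) < K / 2 then q c.1 else -q c.1).apply N X).IsBlockSparse N ∧
      (((glue K liveL liveR L R M).toBlock
        fun b c => if (b : ℕ) < K / 2 then q c.1 else -q c.1).apply N X).tensor =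
      (glue K liveL liveR L R M).matrix.mulVec X.tensor := by
  have hT := shiftConsistent_glue (liveL := liveL) (liveR := liveR) q hL hR hM
  have p0 : ∀ c, (if ((0 : Fin (K + 1)) : ℕ) < K / 2 then liveL (0 : Fin (K + 1)) c
      else liveR (0 : Fin (K + 1)) c) ↔ c = c₀ := fun c => by
    rw [if_pos (by simpa using hK0)]; exact h0 c
  have pK : ∀ c, (if ((Fin.last K : Fin (K + 1)) : ℕ) < K / 2 then liveL (Fin.last K : Fin (K + 1)) c
      else liveR (Fin.last K : Fin (K + 1)) c) ↔ c = c₀ := fun c => by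
    rw [if_neg (by simp; omega)]; exact hK c
  have s0 : ∀ m : (glue K liveL liveR L R M).Bond 0,
      (if ((0 : Fin (K + 1)) : ℕ) < K / 2 then q m.1 else -q m.1) = 0 := fun m => by
    rw [(p0 m.1).1 m.2, hq]; simp
  have sK : ∀ m : (glue K liveL liveR L R M).Bond (Fin.last K),
      (if ((Fin.last K : Fin (K + 1)) : ℕ) < K / 2 then q m.1 else -q m.1) = 0 := fun m => by
    rw [(pK m.1).1 m.2, hq]; simp
  exact ⟨apply_isBlockSparse hX hT hN (card_glue_bond 0 c₀ p0)
    (card_glue_bond (Fin.last K) c₀ pK) s0 sK,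
    apply_tensor hX hT s0 sK⟩

namespace Chan₁

variable {K : ℕ}

lemma changesBy_coreL (t : Fin K → Fin K → ℝ) (k : Fin K) (m m' : Chan₁ K) :
    ChangesBy (charge m' - charge m) (coreL t k m m') := by
  cases m <;> cases m' <;>
    first
    | exact changesBy_single _ _ (Or.inl rfl)
    | exact changesBy_delta _ _ (by simp [charge, Comp.charge])
    | exact changesBy_single _ _ (Or.inr (by simp [charge, Comp.charge]))

lemma charge_mid (t : Fin K → Fin K → ℝ) (m m' : Chan₁ K) (h : mid t m m' ≠ 0) :
    charge m' = -charge m := by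
  cases m <;> cases m' <;> simp_all [mid, charge]

end Chan₁

namespace Chan₂

variable {K : ℕ}

lemma changesBy_coreL (w : Fin K → Fin K → Fin K → Fin K → ℝ) (k : Fin K) (m m' : Chan₂ K) :
    ChangesBy (charge m' - charge m) (coreL w k m m') := by
  cases m <;> cases m' <;>
    first
    | exact changesBy_single _ _ (Or.inl rfl)
    | exact changesBy_delta _ _ (by simp [charge, Comp.charge])
    | exact changesBy_single _ _ (Or.inr (by simp [charge, Comp.charge]))

lemma charge_flip (m : Chan₂ K) : charge (flip m) = charge m := by cases m <;> rfl

lemma charge_mid (w : Fin K → Fin K → Fin K → Fin K → ℝ) (m m' : Chan₂ K) (h : mid w m m' ≠ 0) :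
    charge m' = -charge m := by
  cases m <;> cases m' <;> simp_all [mid, charge]

end Chan₂

end FockMPS

end

/-! ### Conclusion for both operators -/

theorem mainTheorem8 (K N : ℕ) (hK : Even K) (hK0 : 0 < K) (hN : N ≤ K)
    (t : Fin K → Fin K → ℝ) (v : Fin K → Fin K → Fin K → Fin K → ℝ)
    (X : FockMPS.MPS K) (hX : X.IsBlockSparse N) :
    (((FockMPS.oneParticleBlockMPO t).apply N X).IsBlockSparse N ∧
      ((FockMPS.oneParticleBlockMPO t).apply N X).tensor =
        (FockMPS.oneParticleOp t).mulVec X.tensor) ∧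
    (((FockMPS.twoParticleBlockMPO v).apply N X).IsBlockSparse N ∧
      ((FockMPS.twoParticleBlockMPO v).apply N X).tensor =
        (FockMPS.twoParticleOp v).mulVec X.tensor) := by
  -- Evenness enters only here: it excludes `K = 1`, for which the left half would be empty.
  have h0 : 0 < K / 2 := by obtain ⟨n, rfl⟩ := hK; omega
  constructor
  · have hmat : FockMPS.oneParticleOp t = (FockMPS.oneParticleMPO t).matrix := by
      ext α β
      rw [FockMPS.oneParticleOp_apply, FockMPS.Chan₁.matrix_eq t h0]
    rw [hmat]
    refine FockMPS.glue_apply FockMPS.Chan₁.charge (FockMPS.Chan₁.changesBy_coreL t)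
      (fun k m m' => ?_) (FockMPS.Chan₁.charge_mid t) .id rfl (fun c => ?_) (fun c => ?_) h0 hN hX
    · rw [FockMPS.Chan₁.coreR_eq]
      exact FockMPS.Chan₁.changesBy_coreL t k m' m
    · cases c <;> simp [FockMPS.Chan₁.liveL]
    · cases c <;> simp [FockMPS.Chan₁.liveR]
  · have hmat : FockMPS.twoParticleOp v = (FockMPS.twoParticleMPO v).matrix := by
      ext α β
      rw [FockMPS.twoParticleOp_apply, FockMPS.Chan₂.matrix_eq v h0]
    rw [hmat]
    refine FockMPS.glue_apply FockMPS.Chan₂.charge (FockMPS.Chan₂.changesBy_coreL _)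
      (fun k m m' => ?_) (FockMPS.Chan₂.charge_mid _) .id rfl (fun c => ?_) (fun c => ?_) h0 hN hX
    · rw [FockMPS.Chan₂.coreR_eq, ← FockMPS.Chan₂.charge_flip m, ← FockMPS.Chan₂.charge_flip m']
      exact FockMPS.Chan₂.changesBy_coreL _ k _ _
    · cases c <;> simp [FockMPS.Chan₂.liveL]
    · cases c <;> simp [FockMPS.Chan₂.liveR]
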